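/- Fix $c>0$, $t>0$ and an integer $n\ge 1$. A walker starts at the origin of $\mathbb{R}^d$ and moves with constant speed $c$ during $[0,t]$, changing direction $n$ times; the times between successive changes are $\tau_1,\dots,\tau_n$ and $\tau_{n+1}=t-\sum_{j=1}^n\tau_j$. The directions of the $n+1$ displacements are independent, each given by hyperspherical angles $(\theta_1,\dots,\theta_{d-2},\phi)\in[0,\pi]^{d-2}\times[0,2\pi]$ with joint density $$\frac{\Gamma(\frac d2)}{2\pi^{d/2}}\sin^{d-2}\theta_1\,\sin^{d-3}\theta_2\cdots\sin\theta_{d-2},$$ that is, uniform on the unit sphere. The directions, the vector $(\tau_1,\dots,\tau_n)$ and the number $N$ of changes of direction are independent, and $P(N=n)>0$ (a deterministic $N=n$ is allowed). Suppose that $(\tau_1,\dots,\tau_n)$ has the rescaled Dirichlet density $$\frac{\Gamma((n+1)a)}{\Gamma(a)^{n+1}}\,\frac{1}{t^{(n+1)a-1}}\prod_{j=1}^{n+1}\tau_j^{a-1},\qquad 0<\tau_j<t-\sum_{k=1}^{j-1}\tau_k,\quad 1\le j\le n.$$ Let $X_d(t)$ denote the position at time $t$ when $a=d-1$, $d\ge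 2$, and $Y_d(t)$ the position at time $t$ when $a=\frac d2-1$, $d\ge 3$. **Theorem.** Conditionally on $N=n$, the law of $X_d(t)$, for every $d\ge2$, has with respect to Lebesgue measure on $\mathbb{R}^d$ the density $$p_{X_d}(x,t;n)=\frac{\Gamma\left(\frac{n+1}{2}(d-1)+\frac12\right)}{\Gamma\left(\frac n2(d-1)\right)}\,\frac{(c^2t^2-\|x\|^2)^{\frac n2(d-1)-1}}{\pi^{d/2}(ct)^{(n+1)(d-1)-1}},\qquad \|x\|<ct,$$ and the law of $Y_d(t)$, for every $d\ge3$, has the density $$p_{Y_d}(y,t;n)=\frac{\Gamma\left((n+1)(\frac d2-1)+1\right)}{\Gamma\left(n(\frac d2-1)\right)}\,\frac{(c^2t^2-\|y\|^2)^{n(\frac d2-1)-1}}{\pi^{d/2}(ct)^{2(n+1)(\frac d2-1)}},\qquad \|y\|<ct;$$ both densities vanish for $\|x\|\ge ct$, $\|y\|\ge ct$. -/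

import Mathlib

open MeasureTheory ProbabilityTheory
open scoped BigOperators

noncomputable section

namespace RandomFlight

/-- The hyperspherical angles `(θ₁, …, θ_{d-2}, φ)` of a direction in `ℝ^d`, `d ≥ 2`;
`a.1 i` is `θ_{i+1}` and `a.2` is `φ`. -/
abbrev Angles (d : ℕ) : Type := (Fin (d - 2) → ℝ) × ℝ

/-- The joint density of the angles of one direction,
`Γ(d/2) / (2 π^{d/2}) * sin^{d-2} θ₁ * sin^{d-3} θ₂ * ⋯ * sin θ_{d-2}` on
`[0, π]^{d-2} × [0, 2π]`, and zero elsewhere. -/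
def angleDensity (d : ℕ) : Angles d → ℝ :=
  Set.indicator {a | (∀ i, a.1 i ∈ Set.Icc 0 Real.pi) ∧ a.2 ∈ Set.Icc 0 (2 * Real.pi)}
    fun a => Real.Gamma ((d : ℝ) / 2) / (2 * Real.pi ^ ((d : ℝ) / 2)) *
      ∏ i : Fin (d - 2), Real.sin (a.1 i) ^ (d - 2 - (i : ℕ))

/-- The law of the angles of one direction. -/
def angleLaw (d : ℕ) : Measure (Angles d) :=
  volume.withDensity fun a => ENNReal.ofReal (angleDensity d a)

/-- The unit vector with the given hyperspherical angles:
`(cos θ₁, sin θ₁ cos θ₂, …, sin θ₁ ⋯ sin θ_{d-2} cos φ, sin θ₁ ⋯ sin θ_{d-2} sin φ)`. -/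
def direction (d : ℕ) (a : Angles d) : EuclideanSpace ℝ (Fin d) :=
  WithLp.toLp 2 fun k =>
    (∏ i ∈ Finset.univ.filter (fun i : Fin (d - 2) => (i : ℕ) < (k : ℕ)), Real.sin (a.1 i)) *
      (if h : (k : ℕ) < d - 2 then Real.cos (a.1 ⟨k, h⟩)
        else if (k : ℕ) = d - 2 then Real.cos a.2 else Real.sin a.2)

/-- All `n + 1` intertimes `τ₁, …, τ_n, τ_{n+1}`, where `τ_{n+1} = t - (τ₁ + ⋯ + τ_n)`. -/
def intertimes {n : ℕ} (t : ℝ) (τ : Fin n → ℝ) : Fin (n + 1) → ℝ :=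
  Fin.snoc τ (t - ∑ j, τ j)

/-- The density of the Dirichlet distribution with parameters `(a, …, a)` (`n + 1` of them),
rescaled to total length `t`, as a density of `(τ₁, …, τ_n)`. -/
def dirichletDensity (n : ℕ) (a t : ℝ) : (Fin n → ℝ) → ℝ :=
  Set.indicator {τ | ∀ j, 0 < τ j ∧ τ j < t - ∑ k with k < j, τ k}
    fun τ => Real.Gamma (((n : ℝ) + 1) * a) / Real.Gamma a ^ (n + 1) *
      (1 / t ^ (((n : ℝ) + 1) * a - 1)) * ∏ j, intertimes t τ j ^ (a - 1)

/-- The rescaled Dirichlet law of `(τ₁, …, τ_n)`. -/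
def dirichletLaw (n : ℕ) (a t : ℝ) : Measure (Fin n → ℝ) :=
  volume.withDensity fun τ => ENNReal.ofReal (dirichletDensity n a t τ)

/-- The position at time `t` of the walker that starts at the origin, moves with speed `c`, and
follows the direction with angles `θ j` during the `j`-th of the `n + 1` intertimes. -/
def position {d n : ℕ} (c t : ℝ) (θ : Fin (n + 1) → Angles d) (τ : Fin n → ℝ) :
    EuclideanSpace ℝ (Fin d) :=
  c • ∑ j, intertimes t τ j • direction d (θ j)

/-- The model with `n` changes of direction and Dirichlet parameter `a`: `θ j` are the random angles
of the `j`-th displacement, `τ` the random intertimes, and `N` the random number of changes of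
direction (the case of a non-random number is that of a constant `N`). -/
structure IsFlightModel {Ω : Type*} [MeasurableSpace Ω] (P : Measure Ω) (d n : ℕ) (a t : ℝ)
    (θ : Fin (n + 1) → Ω → Angles d) (τ : Ω → Fin n → ℝ) (N : Ω → ℕ) : Prop where
  /-- each displacement has a uniformly distributed orientation -/
  angles : ∀ j, HasLaw (θ j) (angleLaw d) P
  /-- the orientations of the displacements are independent of each other -/
  indep_angles : iIndepFun θ P
  /-- the intertimes have the rescaled Dirichlet law -/
  times : HasLaw τ (dirichletLaw n a t) P
  /-- orientations and intertimes are independent -/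
  indep_times : IndepFun (fun ω j => θ j ω) τ P
  /-- the number of changes of direction is measurable -/
  measurable_number : Measurable N
  /-- the number of changes of direction is independent of orientations and intertimes -/
  indep_number : IndepFun (fun ω => ((fun j => θ j ω), τ ω)) N P

/-- The claimed density of the position for the Dirichlet parameter `d - 1`. -/
def densityX (d n : ℕ) (c t : ℝ) : EuclideanSpace ℝ (Fin d) → ℝ :=
  Set.indicator {x | ‖x‖ < c * t} fun x =>
    Real.Gamma (((n : ℝ) + 1) / 2 * ((d : ℝ) - 1) + 1 / 2) /
        Real.Gamma ((n : ℝ) / 2 * ((d : ℝ) - 1)) *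
      ((c ^ 2 * t ^ 2 - ‖x‖ ^ 2) ^ ((n : ℝ) / 2 * ((d : ℝ) - 1) - 1) /
        (Real.pi ^ ((d : ℝ) / 2) * (c * t) ^ (((n : ℝ) + 1) * ((d : ℝ) - 1) - 1)))

/-- The claimed density of the position for the Dirichlet parameter `d / 2 - 1`. -/
def densityY (d n : ℕ) (c t : ℝ) : EuclideanSpace ℝ (Fin d) → ℝ :=
  Set.indicator {y | ‖y‖ < c * t} fun y =>
    Real.Gamma (((n : ℝ) + 1) * ((d : ℝ) / 2 - 1) + 1) /
        Real.Gamma ((n : ℝ) * ((d : ℝ) / 2 - 1)) *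
      ((c ^ 2 * t ^ 2 - ‖y‖ ^ 2) ^ ((n : ℝ) * ((d : ℝ) / 2 - 1) - 1) /
        (Real.pi ^ ((d : ℝ) / 2) * (c * t) ^ (2 * ((n : ℝ) + 1) * ((d : ℝ) / 2 - 1))))

end RandomFlight

end

/-!
# The position of a random flight with Dirichlet displacements

The position lies in the ball of radius `c t`, so its law is determined by the moments of its
linear functionals `⟪·, ξ⟫` (`ext_of_moments`: a bounded random variable has a characteristic
function equal to the sum of its moment series). Hence it suffices to compute these moments for the
flight and for the claimed law, and to compare them.

Write `E_m(s)` for the moments of a centred normal variable of variance `s / 2` (`evenMoment`).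
A direction with the given hyperspherical angles has
`E⟪u, ξ⟫ᵐ = E_m(‖ξ‖²) Γ(d/2) / Γ((d + m)/2)` (`integral_inner_direction_pow`), by induction on the
dimension: one peels off the first angle and uses `∑ (m choose i) E_i(s) E_{m-i}(r) = E_m(s + r)`.
The law on the ball with density proportional to `(R² - ‖x‖²)^(b - 1)` has moments
`Rᵐ E_m(‖ξ‖²) Γ(b + d/2) / Γ(b + (d + m)/2)` (`integral_inner_pow_ballLaw`), by the same induction.

The Dirichlet law has mixed moments
`tᵐ ∏ (a)_{k_j} / ((n + 1) a)_m` (`integral_dirichletLaw_prod_pow`), where `(a)_k` is the rising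
factorial. Expanding the `m`-th power of `⟪position, ξ⟫` by the multinomial theorem, the moment of
the flight becomes `m! (c t)ᵐ / ((n + 1) a)_m` times the `m`-th coefficient of the `(n + 1)`-st
power of the series `∑ (a)_k / k! * E⟪u, ξ⟫ᵏ zᵏ`. With `d / 2 = δ`, the coefficient of `z²ᵏ` is
`‖ξ‖²ᵏ (a)_{2k} / (4ᵏ k! (δ)_k)` (`momentCoeff`). The two choices of `a` are those for which these
are the coefficients of a power `Fᵃ` of a fixed series:

* `a = d - 1`, that is `δ = (a + 1) / 2`: the coefficient is `(a/2)_k / k!`, and the required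
  convolution identity is that of Chu and Vandermonde;
* `a = d / 2 - 1`, that is `δ = a + 1`: it is `a / (a + 2k) * (a + 2k choose k) / 4ᵏ`, and the
  identity is that of Rothe and Hagen.

So the `(n + 1)`-st power has the coefficients with `A = (n + 1) a` in place of `a`, and these give
the moments of the law on the ball for which `b + d / 2` is `(A + 1) / 2`, respectively `A + 1`.
-/

namespace RandomFlight

open Finset.HasAntidiagonal (antidiagonal mem_antidiagonal)

/-! ### Convolution identities for rising factorials -/

open Polynomial in
/-- A sequence of polynomials with `c 0 = 1`, `c (k + 1)` vanishing at `0` and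
`c (k + 1) (x + 1) - c (k + 1) x = c k (x + 1 + s)` is of convolution type. For `s = 0` this covers
`(x)_k / k!`, for `s = 1` the Rothe–Hagen coefficients. -/
theorem sum_antidiagonal_of_binomialType (c : ℕ → ℝ[X]) (s : ℝ) (h0 : c 0 = 1)
    (hz : ∀ k, (c (k + 1)).eval 0 = 0)
    (hrec : ∀ k x, (c (k + 1)).eval (x + 1) - (c (k + 1)).eval x = (c k).eval (x + 1 + s))
    (n : ℕ) (x y : ℝ) :
    ∑ p ∈ antidiagonal n, (c p.1).eval x * (c p.2).eval y = (c n).eval (x + y) := by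
  induction n generalizing x y with
  | zero => simp [h0]
  | succ n ih =>
    -- The difference `D` of the two sides, as a polynomial in `x`, is invariant under
    -- `x ↦ x + 1` and vanishes at `0`, hence at every natural number.
    set D : ℝ[X] := ∑ p ∈ antidiagonal (n + 1), c p.1 * C ((c p.2).eval y) -
      (c (n + 1)).comp (X + C y) with hD
    have hev : ∀ z, D.eval z = ∑ p ∈ antidiagonal (n + 1), (c p.1).eval z * (c p.2).eval y -
        (c (n + 1)).eval (z + y) := by
      intro z; simp [hD, eval_finsetSum]
    have hstep : ∀ z, D.eval (z + 1) = D.eval z := by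
      intro z
      have h1 := ih (z + 1 + s) y
      have h2 : ∑ p ∈ antidiagonal n, (c p.1).eval (z + 1 + s) * (c p.2).eval y =
          ∑ p ∈ antidiagonal n, ((c (p.1 + 1)).eval (z + 1) * (c p.2).eval y) -
          ∑ p ∈ antidiagonal n, ((c (p.1 + 1)).eval z * (c p.2).eval y) := by
        rw [← Finset.sum_sub_distrib]
        refine Finset.sum_congr rfl fun p _ => ?_
        rw [← hrec]; ring
      have h3 := hrec n (z + y)
      rw [hev, hev, Finset.Nat.sum_antidiagonal_succ, Finset.Nat.sum_antidiagonal_succ, h0]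
      simp only [eval_one]
      rw [show z + 1 + y = z + y + 1 by ring]
      rw [show z + 1 + s + y = z + y + 1 + s by ring] at h1
      linarith
    have hnat : ∀ m : ℕ, D.eval (m : ℝ) = 0 := by
      intro m
      induction m with
      | zero =>
        rw [hev, Finset.Nat.sum_antidiagonal_succ]
        simp [h0, hz]
      | succ m ihm => rw [Nat.cast_succ, hstep, ihm]
    have hD0 : D = 0 := by
      refine Polynomial.eq_zero_of_infinite_isRoot D ?_
      refine Set.Infinite.mono ?_ (Set.infinite_range_of_injective (Nat.cast_injective (R := ℝ)))
      rintro _ ⟨m, rfl⟩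
      exact hnat m
    have := hev x
    rw [hD0, eval_zero] at this
    linarith

theorem ascPochhammer_eval_eq_Gamma {x : ℝ} (hx : 0 < x) (k : ℕ) :
    (ascPochhammer ℝ k).eval x = Real.Gamma (x + k) / Real.Gamma x := by
  induction k with
  | zero => simp [(Real.Gamma_pos_of_pos hx).ne']
  | succ k ih =>
    have h : (0 : ℝ) < x + k := by positivity
    rw [ascPochhammer_succ_eval, ih, Nat.cast_succ, ← add_assoc, Real.Gamma_add_one h.ne']
    ring

theorem ascPochhammer_eval_add (x : ℝ) (n m : ℕ) :
    (ascPochhammer ℝ (n + m)).eval x =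
      (ascPochhammer ℝ n).eval x * (ascPochhammer ℝ m).eval (x + n) := by
  rw [← ascPochhammer_mul]; simp

theorem ascPochhammer_eval_two_mul (x : ℝ) (k : ℕ) :
    (ascPochhammer ℝ (2 * k)).eval x =
      4 ^ k * (ascPochhammer ℝ k).eval (x / 2) * (ascPochhammer ℝ k).eval ((x + 1) / 2) := by
  induction k with
  | zero => simp
  | succ k ih =>
    rw [show 2 * (k + 1) = 2 * k + 1 + 1 by ring]
    simp only [ascPochhammer_succ_eval, ih]
    push_cast
    ring

/-- The Chu–Vandermonde identity for rising factorials. -/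
theorem sum_antidiagonal_ascPochhammer_div_factorial (n : ℕ) (x y : ℝ) :
    ∑ p ∈ antidiagonal n, (ascPochhammer ℝ p.1).eval x / p.1.factorial *
      ((ascPochhammer ℝ p.2).eval y / p.2.factorial) =
      (ascPochhammer ℝ n).eval (x + y) / n.factorial := by
  have key := sum_antidiagonal_of_binomialType
    (fun k => Polynomial.C ((k.factorial : ℝ)⁻¹) * ascPochhammer ℝ k) 0 (by simp) (by simp) ?_ n x y
  · simpa [div_eq_inv_mul] using key
  · intro k z
    have h1 := ascPochhammer_succ_eval k (z + 1)
    have h2 := ascPochhammer_eval_add z 1 k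
    rw [add_comm 1 k] at h2
    simp only [ascPochhammer_one, Polynomial.eval_X, Nat.cast_one] at h2
    simp only [Polynomial.eval_mul, Polynomial.eval_C, Nat.factorial_succ, add_zero, h1, h2]
    push_cast
    field_simp
    ring

/-- The Rothe–Hagen coefficient `x (x + k + 1) ⋯ (x + 2k - 1) / k!`, that is
`x / (x + 2k) * (x + 2k choose k)`, as a polynomial in `x`. -/
noncomputable def rotheHagen : ℕ → Polynomial ℝ
  | 0 => 1
  | k + 1 => Polynomial.C (((k + 1).factorial : ℝ)⁻¹) * Polynomial.X *
      (ascPochhammer ℝ k).comp (Polynomial.X + Polynomial.C (k + 2 : ℝ))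

theorem rotheHagen_succ_eval (k : ℕ) (x : ℝ) : (rotheHagen (k + 1)).eval x =
    x * (ascPochhammer ℝ k).eval (x + (k + 2)) / (k + 1).factorial := by
  simp [rotheHagen]; ring

theorem rotheHagen_eval_sub (k : ℕ) (x : ℝ) :
    (rotheHagen (k + 1)).eval (x + 1) - (rotheHagen (k + 1)).eval x =
      (rotheHagen k).eval (x + 1 + 1) := by
  cases k with
  | zero => simp [rotheHagen]
  | succ k =>
    have h1 := ascPochhammer_succ_eval k (x + (k + 4))
    have h2 := ascPochhammer_eval_add (x + (k + 3)) 1 k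
    rw [add_comm 1 k] at h2
    simp only [ascPochhammer_one, Polynomial.eval_X, Nat.cast_one] at h2
    simp only [rotheHagen_succ_eval]
    rw [show x + 1 + (((k + 1 : ℕ) : ℝ) + 2) = x + (k + 4) by push_cast; ring,
      show x + (((k + 1 : ℕ) : ℝ) + 2) = x + (k + 3) by push_cast; ring,
      show x + 1 + 1 + ((k : ℝ) + 2) = x + (k + 4) by ring, h1, h2,
      show x + ((k : ℝ) + 3) + 1 = x + (k + 4) by ring]
    have hf : ((k + 1 + 1).factorial : ℝ) = (k + 2) * (k + 1).factorial := by
      rw [Nat.factorial_succ (k + 1)]; push_cast; ring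
    rw [hf]
    field_simp
    ring

/-- The Rothe–Hagen identity. -/
theorem sum_antidiagonal_rotheHagen (n : ℕ) (x y : ℝ) :
    ∑ p ∈ antidiagonal n, (rotheHagen p.1).eval x * (rotheHagen p.2).eval y =
      (rotheHagen n).eval (x + y) :=
  sum_antidiagonal_of_binomialType rotheHagen 1 rfl (by simp [rotheHagen_succ_eval])
    rotheHagen_eval_sub n x y

theorem rotheHagen_eval {x : ℝ} (hx : 0 < x) (k : ℕ) : (rotheHagen k).eval x =
    (ascPochhammer ℝ (2 * k)).eval x / ((ascPochhammer ℝ k).eval (x + 1) * k.factorial) := by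
  cases k with
  | zero => simp [rotheHagen]
  | succ k =>
    have h1 := ascPochhammer_eval_add x 1 (k + 1 + k)
    have h2 := ascPochhammer_eval_add (x + 1) (k + 1) k
    have h3 := ascPochhammer_pos (S := ℝ) (k + 1) (x + 1) (by positivity)
    simp only [ascPochhammer_one, Polynomial.eval_X, Nat.cast_one] at h1
    rw [rotheHagen_succ_eval, show 2 * (k + 1) = 1 + (k + 1 + k) by ring, h1, h2,
      show x + 1 + ((k + 1 : ℕ) : ℝ) = x + (k + 2) by push_cast; ring]
    field_simp

/-- The coefficient `(x)_{2k} / (4ᵏ k! (y)_k)` of `z²ᵏ` in the generating series of one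
displacement, for the Dirichlet parameter `x`, `y = d / 2` and a unit vector `ξ`. -/
noncomputable def momentCoeff (x y : ℝ) (k : ℕ) : ℝ :=
  (ascPochhammer ℝ (2 * k)).eval x / (4 ^ k * k.factorial * (ascPochhammer ℝ k).eval y)

theorem sum_antidiagonal_momentCoeff_half (n : ℕ) {x y : ℝ} (hx : 0 < x) (hy : 0 < y) :
    ∑ p ∈ antidiagonal n, momentCoeff x ((x + 1) / 2) p.1 * momentCoeff y ((y + 1) / 2) p.2 =
      momentCoeff (x + y) ((x + y + 1) / 2) n := by
  have key : ∀ {z : ℝ} (_ : 0 < z) (k : ℕ), momentCoeff z ((z + 1) / 2) k =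
      (ascPochhammer ℝ k).eval (z / 2) / k.factorial := by
    intro z hz k
    have := ascPochhammer_pos (S := ℝ) k ((z + 1) / 2) (by positivity)
    rw [momentCoeff, ascPochhammer_eval_two_mul]
    field_simp
  simp only [key hx, key hy, key (add_pos hx hy)]
  rw [sum_antidiagonal_ascPochhammer_div_factorial, add_div]

theorem sum_antidiagonal_momentCoeff_add_one (n : ℕ) {x y : ℝ} (hx : 0 < x) (hy : 0 < y) :
    ∑ p ∈ antidiagonal n, momentCoeff x (x + 1) p.1 * momentCoeff y (y + 1) p.2 =
      momentCoeff (x + y) (x + y + 1) n := by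
  have key : ∀ {z : ℝ} (_ : 0 < z) (k : ℕ), momentCoeff z (z + 1) k =
      (rotheHagen k).eval z / 4 ^ k := by
    intro z hz k
    rw [momentCoeff, rotheHagen_eval hz, div_div]
    congr 1; ring
  simp only [key hx, key hy, key (add_pos hx hy)]
  rw [← sum_antidiagonal_rotheHagen, Finset.sum_div]
  refine Finset.sum_congr rfl fun p hp => ?_
  rw [← mem_antidiagonal.1 hp, pow_add]
  field_simp

/-! ### Even moments and sums over even indices -/

/-- The `m`-th moment of a centred normal variable of variance `s / 2`, written for all real `s`:
`m! / (4ᵏ k!) * sᵏ` for `m = 2k`, and `0` for odd `m`. -/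
noncomputable def evenMoment (s : ℝ) (m : ℕ) : ℝ :=
  if Even m then (m.factorial : ℝ) / (4 ^ (m / 2) * (m / 2).factorial) * s ^ (m / 2) else 0

theorem evenMoment_zero (s : ℝ) : evenMoment s 0 = 1 := by simp [evenMoment]

theorem evenMoment_of_odd {m : ℕ} (hm : ¬ Even m) (s : ℝ) : evenMoment s m = 0 := by
  simp [evenMoment, hm]

theorem evenMoment_two_mul (s : ℝ) (k : ℕ) : evenMoment s (2 * k) =
    ((2 * k).factorial : ℝ) / (4 ^ k * k.factorial) * s ^ k := by
  simp [evenMoment]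

theorem evenMoment_mul (s r : ℝ) (m : ℕ) :
    evenMoment (s * r ^ 2) m = r ^ m * evenMoment s m := by
  rcases Nat.even_or_odd' m with ⟨k, rfl | rfl⟩
  · rw [evenMoment_two_mul, evenMoment_two_mul, mul_pow]; ring
  · rw [evenMoment_of_odd (by simp), evenMoment_of_odd (by simp), mul_zero]

theorem sum_antidiagonal_two_mul (f : ℕ × ℕ → ℝ) (k : ℕ)
    (hf : ∀ p ∈ antidiagonal (2 * k), ¬ Even p.1 → f p = 0) :
    ∑ p ∈ antidiagonal (2 * k), f p =
      ∑ p ∈ antidiagonal k, f (2 * p.1, 2 * p.2) := by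
  symm
  refine Finset.sum_of_injOn (fun p => (2 * p.1, 2 * p.2)) ?_ ?_ ?_ (fun _ _ => rfl)
  · rintro ⟨a, b⟩ _ ⟨c, d⟩ _ h
    simp only [Prod.mk.injEq] at h ⊢
    omega
  · rintro ⟨a, b⟩ h
    simp only [SetLike.mem_coe, mem_antidiagonal] at h ⊢
    omega
  · rintro ⟨a, b⟩ h hn
    refine hf _ h fun he => hn ?_
    obtain ⟨i, rfl⟩ := he.two_dvd
    simp only [mem_antidiagonal] at h
    refine ⟨(i, k - i), ?_, ?_⟩
    · simp only [SetLike.mem_coe, mem_antidiagonal]; omega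
    · simp only [Prod.mk.injEq, true_and]; omega

theorem sum_antidiagonal_odd (f : ℕ × ℕ → ℝ) {m : ℕ} (hm : ¬ Even m)
    (hf : ∀ p ∈ antidiagonal m, ¬ Even p.1 ∨ ¬ Even p.2 → f p = 0) :
    ∑ p ∈ antidiagonal m, f p = 0 := by
  refine Finset.sum_eq_zero fun p hp => hf p hp ?_
  by_contra! h
  exact hm ((mem_antidiagonal.1 hp) ▸ h.1.add h.2)

/-- The moments of the sum of two independent centred normal variables. -/
theorem sum_choose_mul_evenMoment (s r : ℝ) (m : ℕ) :
    ∑ p ∈ antidiagonal m, (m.choose p.1 : ℝ) * evenMoment s p.1 * evenMoment r p.2 =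
      evenMoment (s + r) m := by
  rcases Nat.even_or_odd' m with ⟨k, rfl | rfl⟩
  · rw [sum_antidiagonal_two_mul _ _ (fun p _ hp => by simp [evenMoment_of_odd hp])]
    rw [evenMoment_two_mul, add_comm s r, (Commute.all r s).add_pow', Finset.mul_sum,
      ← Finset.Nat.sum_antidiagonal_swap]
    refine Finset.sum_congr rfl fun p hp => ?_
    obtain rfl := mem_antidiagonal.1 hp
    simp only [Prod.fst_swap, Prod.snd_swap]
    rw [evenMoment_two_mul, evenMoment_two_mul, nsmul_eq_mul,
      Nat.cast_choose ℝ (by omega : 2 * p.2 ≤ 2 * (p.1 + p.2)),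
      Nat.cast_choose ℝ (by omega : p.1 ≤ p.1 + p.2),
      show 2 * (p.1 + p.2) - 2 * p.2 = 2 * p.1 by omega, Nat.add_sub_cancel_left]
    field_simp
    ring
  · rw [evenMoment_of_odd (by simp)]
    refine sum_antidiagonal_odd _ (by simp) ?_
    rintro p _ (h | h) <;> simp [evenMoment_of_odd h]

/-! ### One-dimensional integrals -/

theorem pi_rpow_half (d : ℕ) : Real.pi ^ ((d : ℝ) / 2) = √Real.pi ^ d := by
  rw [Real.sqrt_eq_rpow, ← Real.rpow_natCast, ← Real.rpow_mul Real.pi_pos.le]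
  congr 1; ring

theorem sqrt_pi_mul_evenMoment_one {i : ℕ} (hi : Even i) :
    √Real.pi * evenMoment 1 i = Real.Gamma (((i : ℝ) + 1) / 2) := by
  obtain ⟨k, rfl⟩ := hi.two_dvd
  clear hi
  induction k with
  | zero =>
    rw [← Real.Gamma_one_half_eq]
    simp [evenMoment_zero]
  | succ k ih =>
    rw [show (((2 * (k + 1) : ℕ) : ℝ) + 1) / 2 = (((2 * k : ℕ) : ℝ) + 1) / 2 + 1 by push_cast; ring,
      Real.Gamma_add_one (by positivity), ← ih, evenMoment_two_mul, evenMoment_two_mul,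
      show 2 * (k + 1) = 2 * k + 1 + 1 by ring, Nat.factorial_succ, Nat.factorial_succ,
      Nat.factorial_succ]
    push_cast
    field_simp
    ring

/-- Euler's beta integral, scaled to `(0, t)`. -/
theorem lintegral_rpow_mul_sub_rpow {α β t : ℝ} (hα : 0 < α) (hβ : 0 < β) (ht : 0 < t) :
    ∫⁻ s in Set.Ioo 0 t, ENNReal.ofReal (s ^ (α - 1) * (t - s) ^ (β - 1)) =
      ENNReal.ofReal (t ^ (α + β - 1) * (Real.Gamma α * Real.Gamma β / Real.Gamma (α + β))) := by
  have himg : (fun u : ℝ => t * u) '' Set.Ioo 0 1 = Set.Ioo 0 t := by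
    rw [Set.image_mul_left_Ioo ht]; simp
  have h := lintegral_image_eq_lintegral_abs_deriv_mul (f := fun u : ℝ => t * u)
    (f' := fun _ => t) measurableSet_Ioo
    (fun x _ => by simpa using ((hasDerivAt_id x).const_mul t).hasDerivWithinAt)
    ((mul_right_injective₀ ht.ne').injOn (s := Set.Ioo 0 1))
    (fun s => ENNReal.ofReal (s ^ (α - 1) * (t - s) ^ (β - 1)))
  have hB := beta_pos hα hβ
  have h1 := lintegral_betaPDF_eq_one hα hβ
  rw [lintegral_betaPDF] at h1
  rw [himg] at h
  rw [h]
  have h2 : ∀ u ∈ Set.Ioo (0 : ℝ) 1, ENNReal.ofReal |t| *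
      ENNReal.ofReal ((t * u) ^ (α - 1) * (t - t * u) ^ (β - 1)) =
      ENNReal.ofReal (t ^ (α + β - 1) * beta α β) *
        ENNReal.ofReal (1 / beta α β * u ^ (α - 1) * (1 - u) ^ (β - 1)) := by
    intro u hu
    rw [← ENNReal.ofReal_mul (by positivity), ← ENNReal.ofReal_mul (by positivity), abs_of_pos ht,
      show t - t * u = t * (1 - u) by ring, Real.mul_rpow ht.le hu.1.le,
      Real.mul_rpow ht.le (by linarith [hu.2]),
      show α + β - 1 = 1 + (α - 1) + (β - 1) by ring, Real.rpow_add ht, Real.rpow_add ht,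
      Real.rpow_one]
    congr 1
    field_simp
  rw [setLIntegral_congr_fun measurableSet_Ioo h2, lintegral_const_mul' _ _ ENNReal.ofReal_ne_top,
    h1, mul_one, beta]

/-- The truncated power: `u ^ p` for `0 < u`, and `0` for `u ≤ 0`, also when `p ≤ 0`. -/
noncomputable def truncPow (p u : ℝ) : ℝ := if 0 < u then u ^ p else 0

theorem truncPow_nonneg (p u : ℝ) : 0 ≤ truncPow p u := by
  unfold truncPow; split_ifs <;> positivity

@[fun_prop]
theorem measurable_truncPow (p : ℝ) : Measurable (truncPow p) :=
  Measurable.ite measurableSet_Ioi (by fun_prop) (by fun_prop)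

theorem lintegral_pow_mul_truncPow {β : ℝ} (hβ : 0 < β) (S : ℝ) (i : ℕ) :
    ∫⁻ x : ℝ, ENNReal.ofReal (|x| ^ i * truncPow (β - 1) (S - x ^ 2)) =
      ENNReal.ofReal (truncPow (β + ((i : ℝ) + 1) / 2 - 1) S *
        (Real.Gamma (((i : ℝ) + 1) / 2) * Real.Gamma β /
          Real.Gamma (β + ((i : ℝ) + 1) / 2))) := by
  rcases le_or_gt S 0 with hS | hS
  · have h0 : ∀ x : ℝ, truncPow (β - 1) (S - x ^ 2) = 0 := fun x => by
      rw [truncPow, if_neg (by nlinarith [sq_nonneg x])]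
    simp only [h0]
    simp [truncPow, hS.not_gt]
  -- By symmetry it suffices to integrate over `(0, √S)`, where `u = x²` gives a beta integral.
  set f : ℝ → ENNReal := fun x => ENNReal.ofReal (|x| ^ i * truncPow (β - 1) (S - x ^ 2)) with hf
  have hhalf : ∫⁻ x, f x = 2 * ∫⁻ x in Set.Ioi 0, f x := by
    have h1 : ∫⁻ x in Set.Iio 0, f x = ∫⁻ x in Set.Ioi 0, f x := by
      have := (Measure.measurePreserving_neg (volume : Measure ℝ)).setLIntegral_comp_preimage_emb
        (MeasurableEquiv.neg ℝ).measurableEmbedding f (Set.Iio 0)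
      rw [← this]
      simp [hf]
    rw [← lintegral_add_compl f measurableSet_Ioi, Set.compl_Ioi, two_mul,
      setLIntegral_congr Iio_ae_eq_Iic.symm, h1]
  have hrt : 0 < √S := Real.sqrt_pos.2 hS
  have hsupp : ∫⁻ x in Set.Ioi 0, f x = ∫⁻ x in Set.Ioo 0 (√S), f x := by
    rw [← lintegral_inter_add_sdiff f (Set.Ioi 0) (measurableSet_Ioo (a := 0) (b := √S)),
      Set.inter_eq_right.2 Set.Ioo_subset_Ioi_self, setLIntegral_eq_zero
      (measurableSet_Ioi.diff measurableSet_Ioo), add_zero]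
    rintro x ⟨hx, hx'⟩
    have hx2 : √S ≤ x := by
      by_contra! h; exact hx' ⟨hx, h⟩
    have : S ≤ x ^ 2 := (Real.sqrt_le_left (le_of_lt hx)).1 hx2
    simp [hf, truncPow, this.not_gt]
  have himg : (fun u : ℝ => u ^ 2) '' Set.Ioo 0 (√S) = Set.Ioo 0 S := by
    ext y
    constructor
    · rintro ⟨x, hx, rfl⟩
      exact ⟨pow_pos hx.1 2, (Real.lt_sqrt hx.1.le).1 hx.2⟩
    · intro hy
      exact ⟨√y, ⟨Real.sqrt_pos.2 hy.1, Real.sqrt_lt_sqrt hy.1.le hy.2⟩, Real.sq_sqrt hy.1.le⟩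
  have h := lintegral_image_eq_lintegral_abs_deriv_mul (f := fun u : ℝ => u ^ 2)
    (f' := fun u => 2 * u) measurableSet_Ioo
    (fun x _ => by simpa using (hasDerivAt_pow 2 x).hasDerivWithinAt)
    (s := Set.Ioo 0 (√S))
    (fun x hx y hy hxy => (sq_eq_sq₀ hx.1.le hy.1.le).1 hxy)
    (fun s => ENNReal.ofReal (s ^ (((i : ℝ) + 1) / 2 - 1) * (S - s) ^ (β - 1)))
  rw [himg, lintegral_rpow_mul_sub_rpow (by positivity) hβ hS] at h
  rw [hhalf, hsupp, truncPow, if_pos hS, add_comm β, h, ← lintegral_const_mul' _ _ (by simp)]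
  refine setLIntegral_congr_fun measurableSet_Ioo fun x hx => ?_
  have hxS : 0 < S - x ^ 2 := by
    have := (Real.lt_sqrt hx.1.le).1 hx.2
    linarith
  have hx0 := hx.1
  have hpow : (x ^ 2) ^ (((i : ℝ) + 1) / 2 - 1) * x = x ^ i := by
    rw [← Real.rpow_natCast x 2, ← Real.rpow_mul hx0.le]
    nth_rw 2 [← Real.rpow_one x]
    rw [← Real.rpow_add hx0, ← Real.rpow_natCast]
    congr 1
    push_cast
    ring
  simp only [hf]
  rw [truncPow, if_pos hxS, ← ENNReal.ofReal_mul (by positivity),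
    show (2 : ENNReal) = ENNReal.ofReal 2 by simp, ← ENNReal.ofReal_mul (by positivity),
    abs_of_pos hx0, abs_of_pos (by positivity), ← hpow]
  congr 1
  ring

theorem integrable_pow_mul_truncPow {β : ℝ} (hβ : 0 < β) (S : ℝ) (i : ℕ) :
    Integrable fun x : ℝ => x ^ i * truncPow (β - 1) (S - x ^ 2) := by
  refine ⟨by fun_prop, ?_⟩
  rw [hasFiniteIntegral_iff_norm]
  have : ∀ x : ℝ, ‖x ^ i * truncPow (β - 1) (S - x ^ 2)‖ =
      |x| ^ i * truncPow (β - 1) (S - x ^ 2) := fun x => by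
    rw [norm_mul, norm_pow, Real.norm_eq_abs, Real.norm_of_nonneg (truncPow_nonneg _ _)]
  simp only [this]
  rw [lintegral_pow_mul_truncPow hβ]
  exact ENNReal.ofReal_lt_top

theorem integral_pow_mul_truncPow {β : ℝ} (hβ : 0 < β) (S : ℝ) (i : ℕ) :
    ∫ x : ℝ, x ^ i * truncPow (β - 1) (S - x ^ 2) =
      √Real.pi * evenMoment 1 i * Real.Gamma β / Real.Gamma (β + ((i : ℝ) + 1) / 2) *
        truncPow (β + ((i : ℝ) + 1) / 2 - 1) S := by
  by_cases hi : Even i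
  · rw [integral_eq_lintegral_of_nonneg_ae (Filter.Eventually.of_forall fun x =>
      mul_nonneg (hi.pow_nonneg x) (truncPow_nonneg _ _)) (by fun_prop)]
    have := lintegral_pow_mul_truncPow hβ S i
    simp only [hi.pow_abs] at this
    rw [this, ENNReal.toReal_ofReal, sqrt_pi_mul_evenMoment_one hi, mul_comm]
    exact mul_nonneg (truncPow_nonneg _ _) (by positivity)
  · rw [evenMoment_of_odd hi]
    have h := integral_neg_eq_self (fun x : ℝ => x ^ i * truncPow (β - 1) (S - x ^ 2)) volume
    simp only [(Nat.not_even_iff_odd.1 hi).neg_pow, neg_mul, even_two.neg_pow, integral_neg] at h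
    simp only [mul_zero, zero_mul, zero_div]
    linarith

/-- The substitution `x = cos θ` in `integral_pow_mul_truncPow`. -/
theorem integral_cos_pow_mul_sin_pow (i q : ℕ) :
    ∫ θ in Set.Icc 0 Real.pi, Real.cos θ ^ i * Real.sin θ ^ q =
      √Real.pi * evenMoment 1 i * Real.Gamma (((q : ℝ) + 1) / 2) /
        Real.Gamma (((q : ℝ) + i) / 2 + 1) := by
  have himg : Real.cos '' Set.Icc 0 Real.pi = Set.Icc (-1) 1 :=
    Real.bijOn_cos.image_eq
  have h := integral_image_eq_integral_abs_deriv_smul (f := Real.cos) (f' := fun θ => -Real.sin θ)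
    (measurableSet_Icc (a := 0) (b := Real.pi))
    (fun x _ => (Real.hasDerivAt_cos x).hasDerivWithinAt) Real.injOn_cos
    (fun x => x ^ i * truncPow (((q : ℝ) + 1) / 2 - 1) (1 - x ^ 2))
  have h2 : ∫ x in Set.Icc (-1) 1, x ^ i * truncPow (((q : ℝ) + 1) / 2 - 1) (1 - x ^ 2) =
      ∫ x : ℝ, x ^ i * truncPow (((q : ℝ) + 1) / 2 - 1) (1 - x ^ 2) := by
    refine setIntegral_eq_integral_of_forall_compl_eq_zero fun x hx => ?_
    have : ¬ (0 < 1 - x ^ 2) := fun hlt => hx (by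
      have := abs_le.1 ((sq_le_one_iff_abs_le_one x).1 (by linarith)); exact this)
    rw [truncPow, if_neg this, mul_zero]
  rw [himg, h2, integral_pow_mul_truncPow (by positivity)] at h
  rw [show ((q : ℝ) + i) / 2 + 1 = ((q : ℝ) + 1) / 2 + ((i : ℝ) + 1) / 2 by ring]
  rw [truncPow, if_pos one_pos, Real.one_rpow, mul_one] at h
  rw [h, integral_Icc_eq_integral_Ioo, integral_Icc_eq_integral_Ioo]
  refine setIntegral_congr_fun measurableSet_Ioo fun θ hθ => ?_
  have hs : 0 < Real.sin θ := Real.sin_pos_of_mem_Ioo hθ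
  simp only [smul_eq_mul, abs_neg, abs_of_pos hs]
  rw [← Real.sin_sq, truncPow, if_pos (by positivity)]
  have hpow : Real.sin θ * (Real.sin θ ^ 2) ^ (((q : ℝ) + 1) / 2 - 1) = Real.sin θ ^ q := by
    rw [← Real.rpow_natCast (Real.sin θ) 2, ← Real.rpow_mul hs.le]
    nth_rw 1 [← Real.rpow_one (Real.sin θ)]
    rw [← Real.rpow_add hs, ← Real.rpow_natCast]
    congr 1
    push_cast
    ring
  rw [← hpow]; ring

/-! ### Peeling off the first coordinate -/

theorem measurePreserving_cons (n : ℕ) :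
    MeasurePreserving (fun p : ℝ × (Fin n → ℝ) => (Fin.cons p.1 p.2 : Fin (n + 1) → ℝ)) := by
  have h := (volume_preserving_piFinSuccAbove (fun _ : Fin (n + 1) => ℝ) 0).symm
  convert h using 1
  ext p i
  simp [MeasurableEquiv.piFinSuccAbove_symm_apply, Fin.insertNthEquiv]

theorem measurableEmbedding_cons (n : ℕ) :
    MeasurableEmbedding (fun p : ℝ × (Fin n → ℝ) => (Fin.cons p.1 p.2 : Fin (n + 1) → ℝ)) := by
  convert (MeasurableEquiv.piFinSuccAbove (fun _ : Fin (n + 1) => ℝ) 0).symm.measurableEmbedding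
    using 1
  ext p i
  simp [MeasurableEquiv.piFinSuccAbove_symm_apply, Fin.insertNthEquiv]

theorem lintegral_cons {n : ℕ} {f : (Fin (n + 1) → ℝ) → ENNReal} (hf : Measurable f) :
    ∫⁻ x, f x = ∫⁻ s : ℝ, ∫⁻ y : Fin n → ℝ, f (Fin.cons s y) := by
  rw [← (measurePreserving_cons n).lintegral_comp hf, Measure.volume_eq_prod, lintegral_prod]
  exact (hf.comp (measurePreserving_cons n).measurable).aemeasurable

theorem integral_cons {n : ℕ} {f : (Fin (n + 1) → ℝ) → ℝ} (hf : Integrable f) :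
    ∫ x, f x = ∫ s : ℝ, ∫ y : Fin n → ℝ, f (Fin.cons s y) := by
  rw [← (measurePreserving_cons n).integral_comp (measurableEmbedding_cons n),
    Measure.volume_eq_prod, integral_prod]
  rw [← Measure.volume_eq_prod]
  exact ((measurePreserving_cons n).integrable_comp_emb (measurableEmbedding_cons n)).2 hf

/-! ### Moments of the Dirichlet law -/

/-- The set of admissible intertimes, the support of the Dirichlet density. -/
def timeRegion (n : ℕ) (t : ℝ) : Set (Fin n → ℝ) :=
  {τ | ∀ j, 0 < τ j ∧ τ j < t - ∑ k with k < j, τ k}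

theorem measurableSet_timeRegion (n : ℕ) (t : ℝ) : MeasurableSet (timeRegion n t) := by
  unfold timeRegion
  simp only [Set.ofPred_forall, Set.ofPred_and]
  exact MeasurableSet.iInter fun j =>
    (measurableSet_lt (by fun_prop) (by fun_prop)).inter
      (measurableSet_lt (by fun_prop) (by fun_prop))

theorem intertimes_cons {n : ℕ} (t s : ℝ) (y : Fin n → ℝ) :
    intertimes t (Fin.cons s y : Fin (n + 1) → ℝ) = Fin.cons s (intertimes (t - s) y) := by
  rw [intertimes, intertimes, Fin.cons_snoc_eq_snoc_cons, Fin.sum_univ_succ]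
  simp [sub_sub]

theorem cons_mem_timeRegion {n : ℕ} {t s : ℝ} {y : Fin n → ℝ} :
    (Fin.cons s y : Fin (n + 1) → ℝ) ∈ timeRegion (n + 1) t ↔
      s ∈ Set.Ioo 0 t ∧ y ∈ timeRegion n (t - s) := by
  simp only [timeRegion, Set.mem_ofPred_eq, Fin.forall_fin_succ, Fin.cons_zero, Fin.cons_succ,
    Finset.sum_filter, Fin.sum_univ_succ, Fin.succ_pos, if_true, Fin.succ_lt_succ_iff,
    Fin.not_lt_zero, if_false, Finset.sum_const_zero, Set.mem_Ioo, lt_irrefl, add_zero, sub_zero,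
    sub_sub]

theorem sum_intertimes {n : ℕ} (t : ℝ) (τ : Fin n → ℝ) : ∑ j, intertimes t τ j = t := by
  simp [intertimes, Fin.sum_univ_castSucc]

theorem intertimes_pos {n : ℕ} {t : ℝ} (ht : 0 < t) {τ : Fin n → ℝ} (h : τ ∈ timeRegion n t)
    (j : Fin (n + 1)) : 0 < intertimes t τ j := by
  induction n generalizing t with
  | zero =>
    obtain rfl : j = Fin.last 0 := Fin.fin_one_eq_zero j
    rw [intertimes, Fin.snoc_last]
    simpa using ht
  | succ n ih =>
    obtain ⟨s, y, rfl⟩ : ∃ s y, τ = Fin.cons s y := ⟨τ 0, Fin.tail τ, (Fin.cons_self_tail τ).symm⟩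
    rw [cons_mem_timeRegion] at h
    rw [intertimes_cons]
    refine Fin.cases ?_ (fun i => ?_) j
    · exact h.1.1
    · exact ih (sub_pos.2 h.1.2) h.2 i

@[fun_prop]
theorem measurable_intertimes {n : ℕ} (t : ℝ) (j : Fin (n + 1)) :
    Measurable fun τ : Fin n → ℝ => intertimes t τ j := by
  refine Fin.lastCases ?_ (fun i => ?_) j
  · simp only [intertimes, Fin.snoc_last]; fun_prop
  · simp only [intertimes, Fin.snoc_castSucc]; fun_prop

/-- Dirichlet's integral over the simplex, with arbitrary positive parameters. -/
theorem lintegral_dirichlet {n : ℕ} (α : Fin (n + 1) → ℝ) (hα : ∀ j, 0 < α j) {t : ℝ}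
    (ht : 0 < t) :
    ∫⁻ τ, (timeRegion n t).indicator
      (fun τ => ENNReal.ofReal (∏ j, intertimes t τ j ^ (α j - 1))) τ =
      ENNReal.ofReal (t ^ (∑ j, α j - 1) * ((∏ j, Real.Gamma (α j)) / Real.Gamma (∑ j, α j))) := by
  induction n generalizing t with
  | zero =>
    have hm : ∀ τ : Fin 0 → ℝ, τ ∈ timeRegion 0 t := fun _ j => j.elim0
    have h1 : (Real.Gamma (α 0)) ≠ 0 := (Real.Gamma_pos_of_pos (hα 0)).ne'
    rw [lintegral_unique, Set.indicator_of_mem (hm _)]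
    have h2 : ∀ τ : Fin 0 → ℝ, intertimes t τ 0 = t := fun τ => by
      rw [show (0 : Fin 1) = Fin.last 0 from rfl, intertimes, Fin.snoc_last]; simp
    simp [h1, h2, volume_pi]
  | succ n ih =>
    have hsum : 0 < ∑ j : Fin (n + 1), α j.succ := Finset.sum_pos (fun j _ => hα _) ⟨0, by simp⟩
    have hcons : ∀ s : ℝ, ∫⁻ y : Fin n → ℝ, (timeRegion (n + 1) t).indicator
        (fun τ => ENNReal.ofReal (∏ j, intertimes t τ j ^ (α j - 1))) (Fin.cons s y) =
        (Set.Ioo 0 t).indicator (fun s =>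
          ENNReal.ofReal ((∏ j : Fin (n + 1), Real.Gamma (α j.succ)) /
            Real.Gamma (∑ j : Fin (n + 1), α j.succ)) *
          ENNReal.ofReal (s ^ (α 0 - 1) * (t - s) ^ (∑ j : Fin (n + 1), α j.succ - 1))) s := by
      intro s
      by_cases hs : s ∈ Set.Ioo 0 t
      · have hpow : 0 ≤ s ^ (α 0 - 1) := Real.rpow_nonneg hs.1.le _
        have := ih (fun j => α j.succ) (fun j => hα _) (sub_pos.2 hs.2)
        rw [Set.indicator_of_mem hs, ENNReal.ofReal_mul hpow, mul_left_comm,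
          ← ENNReal.ofReal_mul (div_nonneg (Finset.prod_nonneg fun j _ =>
            (Real.Gamma_pos_of_pos (hα _)).le) (Real.Gamma_pos_of_pos hsum).le),
          mul_comm (_ / _), ← this,
          ← lintegral_const_mul' _ _ ENNReal.ofReal_ne_top]
        congr 1
        ext y
        by_cases hy : y ∈ timeRegion n (t - s)
        · rw [Set.indicator_of_mem (cons_mem_timeRegion.2 ⟨hs, hy⟩), Set.indicator_of_mem hy,
            ← ENNReal.ofReal_mul hpow, Fin.prod_univ_succ, intertimes_cons]
          simp
        · rw [Set.indicator_of_notMem (fun h => hy (cons_mem_timeRegion.1 h).2),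
            Set.indicator_of_notMem hy, mul_zero]
      · rw [Set.indicator_of_notMem hs]
        have : ∀ y : Fin n → ℝ, (Fin.cons s y : Fin (n + 1) → ℝ) ∉ timeRegion (n + 1) t :=
          fun y h => hs (cons_mem_timeRegion.1 h).1
        simp [Set.indicator_of_notMem (this _)]
    rw [lintegral_cons ((by fun_prop : Measurable _).indicator (measurableSet_timeRegion _ _))]
    simp only [hcons]
    rw [lintegral_indicator measurableSet_Ioo, lintegral_const_mul' _ _ ENNReal.ofReal_ne_top,
      lintegral_rpow_mul_sub_rpow (hα 0) hsum ht, ← ENNReal.ofReal_mul,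
      Fin.sum_univ_succ (n := n + 1), Fin.prod_univ_succ (n := n + 1)]
    · congr 1
      have := (Real.Gamma_pos_of_pos hsum).ne'
      field_simp
    · exact div_nonneg (Finset.prod_nonneg fun j _ => (Real.Gamma_pos_of_pos (hα _)).le)
        (Real.Gamma_pos_of_pos hsum).le

theorem dirichletDensity_eq_indicator (n : ℕ) (a t : ℝ) :
    dirichletDensity n a t = (timeRegion n t).indicator fun τ =>
      Real.Gamma (((n : ℝ) + 1) * a) / Real.Gamma a ^ (n + 1) *
        (1 / t ^ (((n : ℝ) + 1) * a - 1)) * ∏ j, intertimes t τ j ^ (a - 1) := rfl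

theorem measurable_dirichletDensity (n : ℕ) (a t : ℝ) : Measurable (dirichletDensity n a t) :=
  Measurable.indicator (by fun_prop) (measurableSet_timeRegion n t)

theorem ae_dirichletLaw_mem (n : ℕ) (a t : ℝ) :
    ∀ᵐ τ ∂dirichletLaw n a t, τ ∈ timeRegion n t := by
  rw [dirichletLaw, ae_withDensity_iff']
  · refine Filter.Eventually.of_forall fun τ h => ?_
    by_contra hn
    exact h (by rw [dirichletDensity_eq_indicator, Set.indicator_of_notMem hn, ENNReal.ofReal_zero])
  · exact (measurable_dirichletDensity n a t).ennreal_ofReal.aemeasurable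

/-- The mixed moments of the intertimes: the monomial shifts the parameters of the Dirichlet
integral from `a` to `a + k j`. -/
theorem integral_dirichletLaw_prod_pow {n : ℕ} {a t : ℝ} (ha : 0 < a) (ht : 0 < t)
    (k : Fin (n + 1) → ℕ) :
    ∫ τ, ∏ j, intertimes t τ j ^ k j ∂dirichletLaw n a t =
      t ^ (∑ j, k j) * (∏ j, Real.Gamma (a + k j) / Real.Gamma a) *
        (Real.Gamma (((n : ℝ) + 1) * a) / Real.Gamma (((n : ℝ) + 1) * a + (∑ j, k j : ℕ))) := by
  have hΓ : 0 < Real.Gamma a := Real.Gamma_pos_of_pos ha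
  have hA : 0 < ((n : ℝ) + 1) * a := by positivity
  rw [integral_eq_lintegral_of_nonneg_ae]
  rotate_left
  · filter_upwards [ae_dirichletLaw_mem n a t] with τ hτ
    exact Finset.prod_nonneg fun j _ => pow_nonneg (intertimes_pos ht hτ j).le _
  · exact Measurable.aestronglyMeasurable (by fun_prop)
  have hmd : Measurable fun τ => ENNReal.ofReal (dirichletDensity n a t τ) :=
    (measurable_dirichletDensity n a t).ennreal_ofReal
  rw [dirichletLaw, lintegral_withDensity_eq_lintegral_mul _ hmd (by fun_prop)]
  set C : ℝ := Real.Gamma (((n : ℝ) + 1) * a) / Real.Gamma a ^ (n + 1) *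
      (1 / t ^ (((n : ℝ) + 1) * a - 1)) with hC
  have hC0 : 0 ≤ C := by
    have := Real.Gamma_pos_of_pos hA
    positivity
  have hpt : ∀ τ : Fin n → ℝ, ((fun τ => ENNReal.ofReal (dirichletDensity n a t τ)) *
      fun τ => ENNReal.ofReal (∏ j, intertimes t τ j ^ k j)) τ =
      ENNReal.ofReal C * (timeRegion n t).indicator
        (fun τ => ENNReal.ofReal (∏ j, intertimes t τ j ^ (a + k j - 1))) τ := by
    intro τ
    simp only [Pi.mul_apply]
    by_cases hτ : τ ∈ timeRegion n t
    · rw [dirichletDensity_eq_indicator, Set.indicator_of_mem hτ, Set.indicator_of_mem hτ, ← hC,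
        ← ENNReal.ofReal_mul hC0, ← ENNReal.ofReal_mul, mul_assoc,
        ← Finset.prod_mul_distrib]
      · congr 2
        refine Finset.prod_congr rfl fun j _ => ?_
        have := intertimes_pos ht hτ j
        rw [← Real.rpow_natCast, ← Real.rpow_add this]
        congr 1; ring
      · exact mul_nonneg hC0 (Finset.prod_nonneg fun j _ =>
          Real.rpow_nonneg (intertimes_pos ht hτ j).le _)
    · rw [dirichletDensity_eq_indicator, Set.indicator_of_notMem hτ, Set.indicator_of_notMem hτ,
        ENNReal.ofReal_zero, zero_mul, mul_zero]
  rw [lintegral_congr hpt, lintegral_const_mul' _ _ ENNReal.ofReal_ne_top,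
    lintegral_dirichlet (fun j => a + (k j : ℝ)) (fun j => by positivity) ht,
    ← ENNReal.ofReal_mul hC0]
  have hs : ∑ j, (a + (k j : ℝ)) = ((n : ℝ) + 1) * a + (∑ j, k j : ℕ) := by
    rw [Finset.sum_add_distrib]; simp
  have hAk : 0 < Real.Gamma (((n : ℝ) + 1) * a + (∑ j, k j : ℕ)) :=
    Real.Gamma_pos_of_pos (by positivity)
  have hP : 0 ≤ ∏ j, Real.Gamma (a + (k j : ℝ)) :=
    Finset.prod_nonneg fun j _ => (Real.Gamma_pos_of_pos (by positivity)).le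
  rw [hs, ENNReal.toReal_ofReal (by positivity), hC, Finset.prod_div_distrib,
    show ((n : ℝ) + 1) * a + (∑ j, k j : ℕ) - 1 = (((n : ℝ) + 1) * a - 1) + (∑ j, k j : ℕ) by ring,
    Real.rpow_add ht, Real.rpow_natCast]
  simp only [Finset.prod_const, Finset.card_univ, Fintype.card_fin]
  field_simp

/-! ### The law on the ball -/

theorem lintegral_truncPow_sub_sum_sq (D : ℕ) {b : ℝ} (hb : 0 < b) (S : ℝ) :
    ∫⁻ x : Fin D → ℝ, ENNReal.ofReal (truncPow (b - 1) (S - ∑ i, x i ^ 2)) =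
      ENNReal.ofReal (√Real.pi ^ D * Real.Gamma b / Real.Gamma (b + (D : ℝ) / 2) *
        truncPow (b + (D : ℝ) / 2 - 1) S) := by
  induction D generalizing S with
  | zero =>
    have := (Real.Gamma_pos_of_pos hb).ne'
    rw [lintegral_unique]
    simp [volume_pi, this]
  | succ D ih =>
    have hbD : 0 < b + (D : ℝ) / 2 := by positivity
    have hG := Real.Gamma_pos_of_pos hbD
    have hG' := Real.Gamma_pos_of_pos hb
    rw [lintegral_cons (by fun_prop)]
    simp only [Fin.sum_univ_succ, Fin.cons_zero, Fin.cons_succ, ← sub_sub, ih]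
    have h1 := lintegral_pow_mul_truncPow hbD S 0
    simp only [pow_zero, one_mul, Nat.cast_zero, zero_add, Real.Gamma_one_half_eq] at h1
    have h2 : ∀ s : ℝ, ENNReal.ofReal (√Real.pi ^ D * Real.Gamma b /
        Real.Gamma (b + (D : ℝ) / 2) * truncPow (b + (D : ℝ) / 2 - 1) (S - s ^ 2)) =
        ENNReal.ofReal (√Real.pi ^ D * Real.Gamma b / Real.Gamma (b + (D : ℝ) / 2)) *
          ENNReal.ofReal (truncPow (b + (D : ℝ) / 2 - 1) (S - s ^ 2)) := fun s =>
      ENNReal.ofReal_mul (by positivity)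
    simp only [h2]
    rw [lintegral_const_mul' _ _ ENNReal.ofReal_ne_top, h1, ← ENNReal.ofReal_mul (by positivity),
      show b + ((D + 1 : ℕ) : ℝ) / 2 = b + (D : ℝ) / 2 + 1 / 2 by push_cast; ring]
    congr 1
    field_simp
    ring

theorem integrable_truncPow_sub_sum_sq (D : ℕ) {b : ℝ} (hb : 0 < b) (S : ℝ) :
    Integrable fun x : Fin D → ℝ => truncPow (b - 1) (S - ∑ i, x i ^ 2) := by
  refine ⟨Measurable.aestronglyMeasurable (by fun_prop), ?_⟩
  rw [hasFiniteIntegral_iff_norm]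
  simp only [Real.norm_of_nonneg (truncPow_nonneg _ _)]
  rw [lintegral_truncPow_sub_sum_sq D hb]
  exact ENNReal.ofReal_lt_top

theorem integrable_pow_mul_truncPow_sub_sum_sq {D : ℕ} (ξ : Fin D → ℝ) (m : ℕ) {b : ℝ}
    (hb : 0 < b) (S : ℝ) :
    Integrable fun x : Fin D → ℝ =>
      (∑ i, ξ i * x i) ^ m * truncPow (b - 1) (S - ∑ i, x i ^ 2) := by
  refine ((integrable_truncPow_sub_sum_sq D hb S).const_mul ((∑ i, |ξ i| * √S) ^ m)).mono'
    (by fun_prop) (Filter.Eventually.of_forall fun x => ?_)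
  rw [norm_mul, Real.norm_of_nonneg (truncPow_nonneg _ _), norm_pow, Real.norm_eq_abs]
  by_cases h : 0 < S - ∑ i, x i ^ 2
  · refine mul_le_mul_of_nonneg_right (pow_le_pow_left₀ (abs_nonneg _) ?_ _) (truncPow_nonneg _ _)
    refine (Finset.abs_sum_le_sum_abs _ _).trans (Finset.sum_le_sum fun i _ => ?_)
    rw [abs_mul]
    refine mul_le_mul_of_nonneg_left (Real.abs_le_sqrt ?_) (abs_nonneg _)
    have := Finset.single_le_sum (f := fun i => x i ^ 2) (fun i _ => sq_nonneg _)
      (Finset.mem_univ i)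
    linarith
  · simp [truncPow, h]

/-- The moments of `(S - ‖x‖²)₊^(b - 1)` in dimension `D`, by induction on `D`: for a fixed first
coordinate `s`, the integral over the others is a combination of truncated powers of `S - s²`. -/
theorem integral_pow_mul_truncPow_sub_sum_sq {D : ℕ} (ξ : Fin D → ℝ) (m : ℕ) {b : ℝ}
    (hb : 0 < b) (S : ℝ) :
    ∫ x : Fin D → ℝ, (∑ i, ξ i * x i) ^ m * truncPow (b - 1) (S - ∑ i, x i ^ 2) =
      evenMoment (∑ i, ξ i ^ 2) m * (√Real.pi ^ D * Real.Gamma b /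
        Real.Gamma (b + ((D : ℝ) + m) / 2)) * truncPow (b + ((D : ℝ) + m) / 2 - 1) S := by
  induction D generalizing S m with
  | zero =>
    have := (Real.Gamma_pos_of_pos hb).ne'
    rw [integral_unique]
    rcases m with _ | m
    · simp [evenMoment_zero, this, measureReal_def, volume_pi]
    · have : evenMoment 0 (m + 1) = 0 := by
        rcases Nat.even_or_odd (m + 1) with he | ho
        · obtain ⟨k, hk⟩ := he.two_dvd
          rw [hk, evenMoment_two_mul, zero_pow (by omega), mul_zero]
        · exact evenMoment_of_odd (Nat.not_even_iff_odd.2 ho) _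
      simp [this]
  | succ D ih =>
    rw [integral_cons (integrable_pow_mul_truncPow_sub_sum_sq ξ m hb S)]
    simp only [Fin.sum_univ_succ, Fin.cons_zero, Fin.cons_succ, ← sub_sub]
    set η : Fin D → ℝ := fun i => ξ i.succ with hη
    set c : ℕ → ℝ := fun j => √Real.pi ^ D * Real.Gamma b / Real.Gamma (b + ((D : ℝ) + j) / 2)
      with hc
    have hpos : ∀ j : ℕ, 0 < b + ((D : ℝ) + j) / 2 := fun j => by positivity
    have hinner : ∀ s : ℝ, ∫ y : Fin D → ℝ, (ξ 0 * s + ∑ i, ξ i.succ * y i) ^ m *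
        truncPow (b - 1) (S - s ^ 2 - ∑ i, y i ^ 2) =
        ∑ p ∈ antidiagonal m, (m.choose p.1 : ℝ) * ξ 0 ^ p.1 *
          (evenMoment (∑ i, η i ^ 2) p.2 * c p.2) *
          (s ^ p.1 * truncPow (b + ((D : ℝ) + p.2) / 2 - 1) (S - s ^ 2)) := by
      intro s
      have h1 : ∀ y : Fin D → ℝ, (ξ 0 * s + ∑ i, ξ i.succ * y i) ^ m *
          truncPow (b - 1) (S - s ^ 2 - ∑ i, y i ^ 2) =
          ∑ p ∈ antidiagonal m, ((m.choose p.1 : ℝ) * (ξ 0 * s) ^ p.1) *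
            ((∑ i, η i * y i) ^ p.2 * truncPow (b - 1) (S - s ^ 2 - ∑ i, y i ^ 2)) := by
        intro y
        rw [(Commute.all _ _).add_pow', Finset.sum_mul]
        refine Finset.sum_congr rfl fun p _ => ?_
        rw [nsmul_eq_mul]; ring
      simp only [h1]
      rw [integral_finsetSum _ fun p _ =>
        (integrable_pow_mul_truncPow_sub_sum_sq η p.2 hb (S - s ^ 2)).const_mul _]
      refine Finset.sum_congr rfl fun p _ => ?_
      rw [integral_const_mul, ih]
      ring
    simp only [hinner]
    rw [integral_finsetSum _ fun p _ => (integrable_pow_mul_truncPow (hpos p.2) S p.1).const_mul _]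
    rw [← sum_choose_mul_evenMoment, Finset.sum_mul, Finset.sum_mul]
    refine Finset.sum_congr rfl fun p hp => ?_
    rw [integral_const_mul, integral_pow_mul_truncPow (hpos p.2)]
    have hm : (m : ℝ) = p.1 + p.2 := by rw [← mem_antidiagonal.1 hp]; push_cast; rfl
    have h2 := evenMoment_mul 1 (ξ 0) p.1
    rw [one_mul] at h2
    have h3 := (Real.Gamma_pos_of_pos (hpos p.2)).ne'
    rw [h2, hc, hm, show b + ((D : ℝ) + p.2) / 2 + ((p.1 : ℝ) + 1) / 2 =
      b + (((D + 1 : ℕ) : ℝ) + (p.1 + p.2)) / 2 by push_cast; ring]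
    simp only [hη]
    field_simp
    ring

/-- The density proportional to `(R² - ‖x‖²)^(b - 1)` on the open ball of radius `R`, and zero
elsewhere. -/
noncomputable def ballDensity (d : ℕ) (b R : ℝ) (x : EuclideanSpace ℝ (Fin d)) : ℝ :=
  Real.Gamma (b + (d : ℝ) / 2) / (Real.Gamma b * √Real.pi ^ d * R ^ (2 * (b + (d : ℝ) / 2 - 1))) *
    truncPow (b - 1) (R ^ 2 - ‖x‖ ^ 2)

@[fun_prop]
theorem measurable_ballDensity (d : ℕ) (b R : ℝ) : Measurable (ballDensity d b R) := by
  unfold ballDensity; fun_prop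

theorem ballDensity_nonneg (d : ℕ) {b R : ℝ} (hb : 0 < b) (hR : 0 < R)
    (x : EuclideanSpace ℝ (Fin d)) : 0 ≤ ballDensity d b R x := by
  have h1 := Real.Gamma_pos_of_pos hb
  have h2 : 0 < Real.Gamma (b + (d : ℝ) / 2) := Real.Gamma_pos_of_pos (by positivity)
  exact mul_nonneg (by positivity) (truncPow_nonneg _ _)

/-- The law on the ball of radius `R` with density `ballDensity d b R`. -/
noncomputable def ballLaw (d : ℕ) (b R : ℝ) : Measure (EuclideanSpace ℝ (Fin d)) :=
  volume.withDensity fun x => ENNReal.ofReal (ballDensity d b R x)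

theorem integral_ballLaw (d : ℕ) {b R : ℝ} (hb : 0 < b) (hR : 0 < R)
    (f : EuclideanSpace ℝ (Fin d) → ℝ) :
    ∫ x, f x ∂ballLaw d b R = ∫ x, ballDensity d b R x * f x := by
  rw [ballLaw, integral_withDensity_eq_integral_toReal_smul (by fun_prop)
    (Filter.Eventually.of_forall fun _ => ENNReal.ofReal_lt_top)]
  simp [ENNReal.toReal_ofReal (ballDensity_nonneg d hb hR _)]

theorem truncPow_sq {R : ℝ} (hR : 0 < R) (p : ℝ) : truncPow p (R ^ 2) = R ^ (2 * p) := by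
  rw [truncPow, if_pos (by positivity), ← Real.rpow_natCast R 2, ← Real.rpow_mul hR.le]
  norm_num

theorem isProbabilityMeasure_ballLaw (d : ℕ) {b R : ℝ} (hb : 0 < b) (hR : 0 < R) :
    IsProbabilityMeasure (ballLaw d b R) := by
  have h1 := Real.Gamma_pos_of_pos hb
  have h2 : 0 < Real.Gamma (b + (d : ℝ) / 2) := Real.Gamma_pos_of_pos (by positivity)
  have h3 : 0 < R ^ (2 * (b + (d : ℝ) / 2 - 1)) := by positivity
  constructor
  rw [ballLaw, withDensity_apply _ MeasurableSet.univ, Measure.restrict_univ,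
    ← (PiLp.volume_preserving_toLp (Fin d)).lintegral_comp (by fun_prop)]
  simp only [ballDensity, EuclideanSpace.norm_sq_eq, Real.norm_eq_abs, sq_abs]
  have h : ∀ x : Fin d → ℝ, ENNReal.ofReal (Real.Gamma (b + (d : ℝ) / 2) /
      (Real.Gamma b * √Real.pi ^ d * R ^ (2 * (b + (d : ℝ) / 2 - 1))) *
        truncPow (b - 1) (R ^ 2 - ∑ i, x i ^ 2)) = ENNReal.ofReal (Real.Gamma (b + (d : ℝ) / 2) /
      (Real.Gamma b * √Real.pi ^ d * R ^ (2 * (b + (d : ℝ) / 2 - 1)))) *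
        ENNReal.ofReal (truncPow (b - 1) (R ^ 2 - ∑ i, x i ^ 2)) := fun x =>
    ENNReal.ofReal_mul (by positivity)
  simp only [h]
  rw [lintegral_const_mul' _ _ ENNReal.ofReal_ne_top, lintegral_truncPow_sub_sum_sq d hb,
    truncPow_sq hR, ← ENNReal.ofReal_mul (by positivity), ENNReal.ofReal_eq_one]
  field_simp

theorem integral_inner_pow_ballLaw {d : ℕ} (ξ : EuclideanSpace ℝ (Fin d)) (m : ℕ) {b R : ℝ}
    (hb : 0 < b) (hR : 0 < R) :
    ∫ x, inner ℝ x ξ ^ m ∂ballLaw d b R = R ^ m * evenMoment (‖ξ‖ ^ 2) m *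
      (Real.Gamma (b + (d : ℝ) / 2) / Real.Gamma (b + (d : ℝ) / 2 + (m : ℝ) / 2)) := by
  have h1 := Real.Gamma_pos_of_pos hb
  have h2 : 0 < Real.Gamma (b + (d : ℝ) / 2) := Real.Gamma_pos_of_pos (by positivity)
  rw [integral_ballLaw d hb hR, ← (PiLp.volume_preserving_toLp (Fin d)).integral_comp
    (MeasurableEquiv.toLp 2 (Fin d → ℝ)).measurableEmbedding]
  have h : ∀ x : Fin d → ℝ, ballDensity d b R (WithLp.toLp 2 x) *
      inner ℝ (WithLp.toLp 2 x) ξ ^ m = Real.Gamma (b + (d : ℝ) / 2) /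
      (Real.Gamma b * √Real.pi ^ d * R ^ (2 * (b + (d : ℝ) / 2 - 1))) *
      ((∑ i, ξ i * x i) ^ m * truncPow (b - 1) (R ^ 2 - ∑ i, x i ^ 2)) := by
    intro x
    simp only [ballDensity, EuclideanSpace.norm_sq_eq, Real.norm_eq_abs, sq_abs, PiLp.inner_apply,
      RCLike.inner_apply, conj_trivial]
    ring
  simp only [h]
  rw [integral_const_mul, integral_pow_mul_truncPow_sub_sum_sq _ _ hb, truncPow_sq hR,
    EuclideanSpace.norm_sq_eq]
  simp only [Real.norm_eq_abs, sq_abs]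
  rw [show 2 * (b + ((d : ℝ) + m) / 2 - 1) = 2 * (b + (d : ℝ) / 2 - 1) + m by ring,
    Real.rpow_add hR, Real.rpow_natCast,
    show b + ((d : ℝ) + m) / 2 = b + (d : ℝ) / 2 + m / 2 by ring]
  field_simp

theorem ae_ballLaw_norm_le (d : ℕ) {b R : ℝ} (hR : 0 < R) :
    ∀ᵐ x ∂ballLaw d b R, ‖x‖ ≤ R := by
  rw [ballLaw, ae_withDensity_iff' (by fun_prop)]
  refine Filter.Eventually.of_forall fun x h => ?_
  by_contra! hn
  refine h ?_
  have : ¬ 0 < R ^ 2 - ‖x‖ ^ 2 := by nlinarith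
  rw [ballDensity, truncPow, if_neg this, mul_zero, ENNReal.ofReal_zero]

/-! ### Moments of a direction -/

/-- The range `[0, π]^D × [0, 2π]` of the hyperspherical angles in dimension `D + 2`. -/
def angleBox (D : ℕ) : Set ((Fin D → ℝ) × ℝ) :=
  {p | (∀ i, p.1 i ∈ Set.Icc 0 Real.pi) ∧ p.2 ∈ Set.Icc 0 (2 * Real.pi)}

theorem isCompact_angleBox (D : ℕ) : IsCompact (angleBox D) := by
  have : angleBox D = (Set.univ.pi fun _ => Set.Icc 0 Real.pi) ×ˢ Set.Icc 0 (2 * Real.pi) := by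
    ext p; simp only [angleBox, Set.mem_ofPred_eq, Set.mem_prod, Set.mem_univ_pi]
  rw [this]
  exact (isCompact_univ_pi fun _ => isCompact_Icc).prod isCompact_Icc

theorem measurableSet_angleBox (D : ℕ) : MeasurableSet (angleBox D) :=
  (isCompact_angleBox D).isClosed.measurableSet

theorem integrableOn_angleBox {D : ℕ} {g : (Fin D → ℝ) × ℝ → ℝ} (hg : Continuous g) :
    IntegrableOn g (angleBox D) :=
  hg.continuousOn.integrableOn_compact (isCompact_angleBox D)

theorem cons_mem_angleBox {D : ℕ} {s : ℝ} {p : (Fin D → ℝ) × ℝ} :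
    ((Fin.cons s p.1 : Fin (D + 1) → ℝ), p.2) ∈ angleBox (D + 1) ↔
      s ∈ Set.Icc 0 Real.pi ∧ p ∈ angleBox D := by
  simp only [angleBox, Set.mem_ofPred_eq, Fin.forall_fin_succ, Fin.cons_zero, Fin.cons_succ,
    and_assoc]

theorem setIntegral_angleBox_succ {D : ℕ} {g : (Fin (D + 1) → ℝ) × ℝ → ℝ} (hg : Continuous g) :
    ∫ p in angleBox (D + 1), g p =
      ∫ s in Set.Icc 0 Real.pi, ∫ p in angleBox D, g (Fin.cons s p.1, p.2) := by
  have hmp := ((measurePreserving_cons D).prod (MeasurePreserving.id (volume : Measure ℝ))).comp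
    (volume_preserving_prodAssoc (α₁ := ℝ) (β₁ := Fin D → ℝ) (γ₁ := ℝ)).symm
  have hme := ((measurableEmbedding_cons D).prodMap (MeasurableEmbedding.id (α := ℝ))).comp
    (MeasurableEquiv.prodAssoc (α := ℝ) (β := Fin D → ℝ) (γ := ℝ)).symm.measurableEmbedding
  have hint : Integrable ((angleBox (D + 1)).indicator g) :=
    (integrable_indicator_iff (measurableSet_angleBox _)).2 (integrableOn_angleBox hg)
  rw [← integral_indicator (measurableSet_angleBox _), ← integral_indicator measurableSet_Icc]
  have h1 := hmp.integral_comp hme ((angleBox (D + 1)).indicator g)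
  have h2 := (hmp.integrable_comp_emb hme).2 hint
  rw [← Measure.volume_eq_prod] at h1
  rw [← h1, Measure.volume_eq_prod]
  refine (integral_prod _ h2).trans ?_
  congr 1
  ext s
  by_cases hs : s ∈ Set.Icc 0 Real.pi
  · rw [Set.indicator_of_mem hs, ← integral_indicator (measurableSet_angleBox _)]
    congr 1
    ext p
    have hmem := cons_mem_angleBox (s := s) (p := p)
    by_cases hp : p ∈ angleBox D
    · rw [Set.indicator_of_mem hp]
      exact Set.indicator_of_mem (hmem.2 ⟨hs, hp⟩) _
    · rw [Set.indicator_of_notMem hp]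
      exact Set.indicator_of_notMem (fun h => hp (hmem.1 h).2) _
  · rw [Set.indicator_of_notMem hs]
    refine integral_eq_zero_of_ae (Filter.Eventually.of_forall fun p => ?_)
    exact Set.indicator_of_notMem (fun h => hs (cons_mem_angleBox.1 h).1) _

/-- The unit vector with given hyperspherical angles in dimension `D + 2`, by recursion on `D`:
`(cos θ₁, sin θ₁ u)` with `u` the unit vector of the remaining angles. -/
noncomputable def hyperspherical : (D : ℕ) → (Fin D → ℝ) → ℝ → Fin (D + 2) → ℝ
  | 0, _, φ => ![Real.cos φ, Real.sin φ]
  | D + 1, θ, φ => Fin.cons (Real.cos (θ 0))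
      fun k => Real.sin (θ 0) * hyperspherical D (Fin.tail θ) φ k

theorem direction_mk_apply (D : ℕ) (θ : Fin D → ℝ) (φ : ℝ) (k : Fin (D + 2)) :
    direction (D + 2) (θ, φ) k = hyperspherical D θ φ k := by
  induction D with
  | zero =>
    fin_cases k <;> simp [direction, hyperspherical]
  | succ D ih =>
    refine Fin.cases ?_ (fun k => ?_) k
    · simp [direction, hyperspherical]
    · rw [hyperspherical, Fin.cons_succ, ← ih (Fin.tail θ) k]
      simp only [direction, Finset.prod_filter]
      have h1 : (∏ i : Fin (D + 1), if (i : ℕ) < (k.succ : ℕ) then Real.sin (θ i) else 1) =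
          Real.sin (θ 0) * ∏ i : Fin D, if (i : ℕ) < (k : ℕ) then Real.sin (θ i.succ) else 1 := by
        rw [Fin.prod_univ_succ]
        simp
      have h2 : ((k.succ : Fin (D + 1 + 2)) : ℕ) = k + 1 := rfl
      have h3 : ((k : ℕ) + 1 < D + 1 + 2 - 2) ↔ (k : ℕ) < D + 2 - 2 := by omega
      have h4 : ((k : ℕ) + 1 = D + 1 + 2 - 2) ↔ (k : ℕ) = D + 2 - 2 := by omega
      refine (congrArg₂ (· * ·) h1 ?_).trans (mul_assoc _ _ _)
      simp only [h2, h3, h4]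
      rfl

theorem direction_apply (D : ℕ) (a : Angles (D + 2)) (k : Fin (D + 2)) :
    direction (D + 2) a k = hyperspherical D a.1 a.2 k :=
  direction_mk_apply D a.1 a.2 k

/-- The weight `sin^D θ₁ sin^{D-1} θ₂ ⋯ sin θ_D` of the uniform law on the sphere in dimension
`D + 2`. -/
noncomputable def sinWeight (D : ℕ) (θ : Fin D → ℝ) : ℝ := ∏ i, Real.sin (θ i) ^ (D - (i : ℕ))

theorem sinWeight_cons (D : ℕ) (s : ℝ) (θ : Fin D → ℝ) :
    sinWeight (D + 1) (Fin.cons s θ) = Real.sin s ^ (D + 1) * sinWeight D θ := by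
  simp [sinWeight, Fin.prod_univ_succ]

@[fun_prop]
theorem continuous_sinWeight (D : ℕ) : Continuous (sinWeight D) := by
  unfold sinWeight; fun_prop

theorem continuous_hyperspherical (D : ℕ) (k : Fin (D + 2)) :
    Continuous fun p : (Fin D → ℝ) × ℝ => hyperspherical D p.1 p.2 k := by
  induction D with
  | zero => fin_cases k <;> simp [hyperspherical] <;> fun_prop
  | succ D ih =>
    refine Fin.cases ?_ (fun k => ?_) k
    · simp only [hyperspherical, Fin.cons_zero]; fun_prop
    · simp only [hyperspherical, Fin.cons_succ]
      refine Continuous.mul (by fun_prop) ((ih k).comp (f := fun p : (Fin (D + 1) → ℝ) × ℝ =>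
        (Fin.tail p.1, p.2)) ?_)
      unfold Fin.tail
      fun_prop

theorem continuous_sinWeight_mul_pow {D : ℕ} (ξ : Fin (D + 2) → ℝ) (m : ℕ) :
    Continuous fun p : (Fin D → ℝ) × ℝ =>
      sinWeight D p.1 * (∑ k, ξ k * hyperspherical D p.1 p.2 k) ^ m := by
  have := continuous_hyperspherical D
  fun_prop

theorem integrable_cos_pow_mul_sin_pow (i j : ℕ) (a b : ℝ) :
    Integrable (fun φ => Real.cos φ ^ i * Real.sin φ ^ j) (volume.restrict (Set.Icc a b)) :=
  Continuous.integrableOn_Icc (by fun_prop)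

theorem integral_cos_pow_mul_sin_pow_circle (i j : ℕ) :
    ∫ φ in Set.Icc 0 (2 * Real.pi), Real.cos φ ^ i * Real.sin φ ^ j =
      2 * Real.pi / Real.Gamma (((i + j : ℕ) : ℝ) / 2 + 1) * evenMoment 1 i * evenMoment 1 j := by
  have hpi := Real.pi_pos
  have hc : Continuous fun φ => Real.cos φ ^ i * Real.sin φ ^ j := by fun_prop
  -- The shift by `π` changes the integrand by the factor `(-1) ^ (i + j)`.
  have h1 : ∫ φ in Set.Icc 0 (2 * Real.pi), Real.cos φ ^ i * Real.sin φ ^ j =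
      (1 + (-1) ^ (i + j)) * ∫ φ in Set.Icc 0 Real.pi, Real.cos φ ^ i * Real.sin φ ^ j := by
    rw [integral_Icc_eq_integral_Ioc, integral_Icc_eq_integral_Ioc,
      ← intervalIntegral.integral_of_le (by positivity),
      ← intervalIntegral.integral_of_le (by positivity),
      ← intervalIntegral.integral_add_adjacent_intervals (b := Real.pi)
        (hc.intervalIntegrable _ _) (hc.intervalIntegrable _ _), add_mul, one_mul]
    congr 1
    have h := intervalIntegral.integral_comp_add_right
      (fun φ => Real.cos φ ^ i * Real.sin φ ^ j) (a := 0) (b := Real.pi) Real.pi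
    rw [zero_add, ← two_mul] at h
    rw [← h, ← intervalIntegral.integral_const_mul]
    congr 1
    ext φ
    rw [Real.cos_add_pi, Real.sin_add_pi, neg_pow, neg_pow (Real.sin φ), pow_add]
    ring
  rw [h1, integral_cos_pow_mul_sin_pow]
  by_cases hi : Even i
  swap
  · rw [evenMoment_of_odd hi]; ring
  by_cases hj : Even j
  swap
  · rw [evenMoment_of_odd hj, (hi.add_odd (Nat.not_even_iff_odd.1 hj)).neg_one_pow]
    ring
  rw [(hi.add hj).neg_one_pow, ← sqrt_pi_mul_evenMoment_one hj, Nat.cast_add, add_comm (j : ℝ)]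
  have : √Real.pi * √Real.pi = Real.pi := Real.mul_self_sqrt hpi.le
  nth_rw 3 [← this]
  ring

/-- The unnormalised moments of a direction in dimension `D + 2`, by induction on `D`: the
functional at `(cos s, sin s • u)` is `ξ₀ cos s + sin s * ⟪u, η⟫`, whose `m`-th power is expanded
binomially. -/
theorem integral_sinWeight_mul_pow {D : ℕ} (ξ : Fin (D + 2) → ℝ) (m : ℕ) :
    ∫ p in angleBox D, sinWeight D p.1 * (∑ k, ξ k * hyperspherical D p.1 p.2 k) ^ m =
      2 * √Real.pi ^ (D + 2) / Real.Gamma (((D : ℝ) + 2 + m) / 2) *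
        evenMoment (∑ k, ξ k ^ 2) m := by
  induction D generalizing m with
  | zero =>
    have hbox : angleBox 0 = Set.univ ×ˢ Set.Icc 0 (2 * Real.pi) := by
      ext p; simp [angleBox]
    rw [hbox, Measure.volume_eq_prod, setIntegral_prod]
    · rw [Measure.restrict_univ, integral_unique]
      have h0 : ∀ (θ : Fin 0 → ℝ) (φ : ℝ), ∑ k, ξ k * hyperspherical 0 θ φ k =
          ξ 0 * Real.cos φ + ξ 1 * Real.sin φ := fun θ φ => Fin.sum_univ_two _
      have h0' : ∑ k, ξ k ^ 2 = ξ 0 ^ 2 + ξ 1 ^ 2 := Fin.sum_univ_two _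
      simp only [h0, h0', sinWeight, Finset.univ_eq_empty, Finset.prod_empty, one_mul]
      have h1 : ∀ φ : ℝ, (ξ 0 * Real.cos φ + ξ 1 * Real.sin φ) ^ m =
          ∑ p ∈ antidiagonal m, ((m.choose p.1 : ℝ) * ξ 0 ^ p.1 * ξ 1 ^ p.2) *
            (Real.cos φ ^ p.1 * Real.sin φ ^ p.2) := fun φ => by
        rw [(Commute.all _ _).add_pow']
        refine Finset.sum_congr rfl fun p _ => ?_
        rw [nsmul_eq_mul]; ring
      simp only [h1]
      rw [integral_finsetSum _ fun p _ =>
        (integrable_cos_pow_mul_sin_pow _ _ _ _).const_mul _]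
      rw [← sum_choose_mul_evenMoment, Finset.mul_sum]
      have hone : (volume : Measure (Fin 0 → ℝ)).real Set.univ = 1 := by
        simp [measureReal_def, volume_pi]
      rw [hone, one_smul]
      refine Finset.sum_congr rfl fun p hp => ?_
      rw [integral_const_mul, integral_cos_pow_mul_sin_pow_circle, mem_antidiagonal.1 hp]
      have h2 := evenMoment_mul 1 (ξ 0) p.1
      have h3 := evenMoment_mul 1 (ξ 1) p.2
      rw [one_mul] at h2 h3
      have hsq : √Real.pi ^ (0 + 2) = Real.pi := Real.sq_sqrt Real.pi_pos.le
      rw [h2, h3, hsq, Nat.cast_zero,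
        show ((0 : ℝ) + 2 + m) / 2 = m / 2 + 1 by ring]
      ring
    · rw [← Measure.volume_eq_prod, ← hbox]
      exact integrableOn_angleBox (continuous_sinWeight_mul_pow ξ m)
  | succ D ih =>
    rw [setIntegral_angleBox_succ (continuous_sinWeight_mul_pow ξ m)]
    set η : Fin (D + 2) → ℝ := fun i => ξ i.succ with hη
    set c : ℕ → ℝ := fun j => 2 * √Real.pi ^ (D + 2) / Real.Gamma (((D : ℝ) + 2 + j) / 2)
      with hc
    have hinner : ∀ s : ℝ, ∫ p in angleBox D, sinWeight (D + 1) (Fin.cons s p.1) *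
        (∑ k, ξ k * hyperspherical (D + 1) (Fin.cons s p.1) p.2 k) ^ m =
        ∑ q ∈ antidiagonal m, ((m.choose q.1 : ℝ) * ξ 0 ^ q.1 *
          (c q.2 * evenMoment (∑ k, η k ^ 2) q.2)) *
          (Real.cos s ^ q.1 * Real.sin s ^ (q.2 + D + 1)) := by
      intro s
      have h1 : ∀ p : (Fin D → ℝ) × ℝ, sinWeight (D + 1) (Fin.cons s p.1) *
          (∑ k, ξ k * hyperspherical (D + 1) (Fin.cons s p.1) p.2 k) ^ m =
          ∑ q ∈ antidiagonal m, ((m.choose q.1 : ℝ) * ξ 0 ^ q.1 *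
            (Real.cos s ^ q.1 * Real.sin s ^ (q.2 + D + 1))) *
            (sinWeight D p.1 * (∑ k, η k * hyperspherical D p.1 p.2 k) ^ q.2) := by
        intro p
        rw [sinWeight_cons, Fin.sum_univ_succ]
        simp only [hyperspherical, Fin.cons_zero, Fin.cons_succ, Fin.tail_cons]
        have h2 : ∑ k : Fin (D + 2), ξ k.succ * (Real.sin s * hyperspherical D p.1 p.2 k) =
            Real.sin s * ∑ k, η k * hyperspherical D p.1 p.2 k := by
          rw [Finset.mul_sum]
          exact Finset.sum_congr rfl fun k _ => by simp only [hη]; ring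
        rw [h2, (Commute.all _ _).add_pow', Finset.mul_sum]
        refine Finset.sum_congr rfl fun q _ => ?_
        rw [nsmul_eq_mul]; ring
      simp only [h1]
      rw [integral_finsetSum _ fun q _ =>
        (integrableOn_angleBox (continuous_sinWeight_mul_pow η q.2)).const_mul _]
      refine Finset.sum_congr rfl fun q _ => ?_
      rw [integral_const_mul, ih]
      ring
    simp only [hinner]
    rw [integral_finsetSum _ fun p _ =>
        (integrable_cos_pow_mul_sin_pow _ _ _ _).const_mul _,
      Fin.sum_univ_succ fun k => ξ k ^ 2,
      ← sum_choose_mul_evenMoment, Finset.mul_sum]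
    refine Finset.sum_congr rfl fun q hq => ?_
    rw [integral_const_mul, integral_cos_pow_mul_sin_pow]
    have hm : (m : ℝ) = q.1 + q.2 := by rw [← mem_antidiagonal.1 hq]; push_cast; rfl
    have h2 := evenMoment_mul 1 (ξ 0) q.1
    rw [one_mul] at h2
    have h3 : Real.Gamma (((D : ℝ) + 2 + q.2) / 2) ≠ 0 :=
      (Real.Gamma_pos_of_pos (by positivity)).ne'
    rw [h2, hc, hm, show (((q.2 + D + 1 : ℕ) : ℝ) + 1) / 2 = ((D : ℝ) + 2 + q.2) / 2 by
        push_cast; ring,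
      show (((q.2 + D + 1 : ℕ) : ℝ) + q.1) / 2 + 1 =
        (((D + 1 : ℕ) : ℝ) + 2 + (q.1 + q.2)) / 2 by push_cast; ring]
    simp only [hη]
    field_simp
    ring

theorem angleDensity_eq_indicator (D : ℕ) : angleDensity (D + 2) =
    (angleBox D).indicator fun a => Real.Gamma (((D + 2 : ℕ) : ℝ) / 2) /
      (2 * Real.pi ^ (((D + 2 : ℕ) : ℝ) / 2)) * sinWeight D a.1 := rfl

theorem measurable_direction (d : ℕ) (hd : 2 ≤ d) : Measurable (direction d) := by
  obtain ⟨D, rfl⟩ := Nat.exists_eq_add_of_le' hd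
  refine (WithLp.measurable_toLp 2 _).comp (measurable_pi_lambda _ fun k => ?_)
  have h : (fun a : Angles (D + 2) => direction (D + 2) a k) =
      fun a => hyperspherical D a.1 a.2 k := funext fun a => direction_apply D a k
  have h' : Measurable fun a : Angles (D + 2) => direction (D + 2) a k :=
    h ▸ (continuous_hyperspherical D k).measurable
  exact h'

theorem integral_inner_direction_pow {d : ℕ} (hd : 2 ≤ d) (ξ : EuclideanSpace ℝ (Fin d)) (m : ℕ) :
    ∫ a, inner ℝ (direction d a) ξ ^ m ∂angleLaw d =
      evenMoment (‖ξ‖ ^ 2) m *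
        (Real.Gamma ((d : ℝ) / 2) / Real.Gamma ((d : ℝ) / 2 + (m : ℝ) / 2)) := by
  obtain ⟨D, rfl⟩ := Nat.exists_eq_add_of_le' hd
  have hΓ : 0 < Real.Gamma (((D + 2 : ℕ) : ℝ) / 2) := Real.Gamma_pos_of_pos (by positivity)
  have hmeas : Measurable (angleDensity (D + 2)) := by
    rw [angleDensity_eq_indicator]
    refine Measurable.indicator ?_ (measurableSet_angleBox D)
    exact ((continuous_sinWeight D).measurable.comp measurable_fst).const_mul _
  have hnn : ∀ a, 0 ≤ angleDensity (D + 2) a := by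
    rw [angleDensity_eq_indicator]
    refine Set.indicator_nonneg fun a ha => mul_nonneg (by positivity) ?_
    exact Finset.prod_nonneg fun i _ => pow_nonneg (Real.sin_nonneg_of_mem_Icc (ha.1 i)) _
  rw [angleLaw, integral_withDensity_eq_integral_toReal_smul hmeas.ennreal_ofReal
    (Filter.Eventually.of_forall fun _ => ENNReal.ofReal_lt_top)]
  simp only [ENNReal.toReal_ofReal (hnn _), smul_eq_mul]
  have h : ∀ a : (Fin D → ℝ) × ℝ, angleDensity (D + 2) a * inner ℝ (direction (D + 2) a) ξ ^ m =
      (angleBox D).indicator (fun a => Real.Gamma (((D + 2 : ℕ) : ℝ) / 2) /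
        (2 * Real.pi ^ (((D + 2 : ℕ) : ℝ) / 2)) *
        (sinWeight D a.1 * (∑ k, ξ k * hyperspherical D a.1 a.2 k) ^ m)) a := by
    intro a
    rw [angleDensity_eq_indicator]
    by_cases ha : a ∈ angleBox D
    · rw [Set.indicator_of_mem ha, Set.indicator_of_mem ha, mul_assoc]
      simp only [PiLp.inner_apply, RCLike.inner_apply, conj_trivial, direction_apply]
    · rw [Set.indicator_of_notMem ha, Set.indicator_of_notMem ha, zero_mul]
  refine (integral_congr_ae (Filter.Eventually.of_forall h)).trans ?_
  refine (integral_indicator (measurableSet_angleBox D)).trans ?_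
  rw [integral_const_mul]
  refine (congrArg _ (integral_sinWeight_mul_pow (fun k => ξ k) m)).trans ?_
  rw [EuclideanSpace.norm_sq_eq]
  simp only [Real.norm_eq_abs, sq_abs]
  rw [show ((D + 2 : ℕ) : ℝ) / 2 + (m : ℝ) / 2 = ((D : ℝ) + 2 + m) / 2 by push_cast; ring]
  rw [pi_rpow_half]
  field_simp

theorem sum_hyperspherical_sq (D : ℕ) (θ : Fin D → ℝ) (φ : ℝ) :
    ∑ k, hyperspherical D θ φ k ^ 2 = 1 := by
  induction D with
  | zero => simp [hyperspherical]
  | succ D ih =>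
    rw [Fin.sum_univ_succ]
    simp only [hyperspherical, Fin.cons_zero, Fin.cons_succ, mul_pow, ← Finset.mul_sum, ih]
    simp

theorem norm_direction {d : ℕ} (hd : 2 ≤ d) (a : Angles d) : ‖direction d a‖ = 1 := by
  obtain ⟨D, rfl⟩ := Nat.exists_eq_add_of_le' hd
  rw [EuclideanSpace.norm_eq]
  simp only [direction_apply, Real.norm_eq_abs, sq_abs, sum_hyperspherical_sq, Real.sqrt_one]

/-! ### The method of moments -/

section MethodOfMoments

variable {E : Type*} [NormedAddCommGroup E] [InnerProductSpace ℝ E] [MeasurableSpace E]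
  [BorelSpace E] [SecondCountableTopology E]

/-- The characteristic function of a boundedly supported measure is the sum of its moment series. -/
theorem charFun_eq_tsum_moments (μ : Measure E) [IsFiniteMeasure μ] {B : ℝ}
    (hμ : ∀ᵐ x ∂μ, ‖x‖ ≤ B) (ξ : E) :
    charFun μ ξ = ∑' m : ℕ, (Complex.I ^ m / m.factorial) *
      ((∫ x, inner ℝ x ξ ^ m ∂μ : ℝ) : ℂ) := by
  set F : ℕ → E → ℂ := fun m x => ((inner ℝ x ξ : ℂ) * Complex.I) ^ m / m.factorial with hF
  have hFn : ∀ m, ∀ᵐ x ∂μ, ‖F m x‖ ≤ (B * ‖ξ‖) ^ m / m.factorial := by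
    intro m
    filter_upwards [hμ] with x hx
    simp only [hF, norm_div, norm_pow, norm_mul, Complex.norm_I, mul_one, Complex.norm_real,
      Complex.norm_natCast]
    gcongr
    exact (norm_inner_le_norm x ξ).trans (by gcongr)
  have hFint : ∀ m, Integrable (F m) μ := fun m =>
    Integrable.of_bound (by fun_prop) _ (hFn m)
  have hsum : Summable fun m => ∫ x, ‖F m x‖ ∂μ := by
    refine Summable.of_nonneg_of_le (fun m => integral_nonneg fun _ => norm_nonneg _) (fun m => ?_)
      ((Real.summable_pow_div_factorial (B * ‖ξ‖)).mul_right (μ.real Set.univ))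
    refine (integral_mono_ae (hFint m).norm (integrable_const _) (hFn m)).trans_eq ?_
    rw [integral_const, smul_eq_mul, mul_comm]
  rw [charFun_apply]
  have hexp : ∀ x : E, Complex.exp (inner ℝ x ξ * Complex.I) = ∑' m, F m x := fun x => by
    rw [Complex.exp_eq_exp_ℂ, NormedSpace.exp_eq_tsum_div]
  simp only [hexp]
  rw [← integral_tsum_of_summable_integral_norm hFint hsum]
  refine tsum_congr fun m => ?_
  rw [← integral_complex_ofReal, ← integral_const_mul]
  congr 1
  ext x
  simp only [hF, mul_pow, Complex.ofReal_pow]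
  ring

/-- Two finite measures with bounded support are equal if all moments of all linear functionals
agree. -/
theorem ext_of_moments [CompleteSpace E] (μ ν : Measure E) [IsFiniteMeasure μ] [IsFiniteMeasure ν]
    {B : ℝ} (hμ : ∀ᵐ x ∂μ, ‖x‖ ≤ B) (hν : ∀ᵐ x ∂ν, ‖x‖ ≤ B)
    (h : ∀ (ξ : E) (m : ℕ), ∫ x, inner ℝ x ξ ^ m ∂μ = ∫ x, inner ℝ x ξ ^ m ∂ν) : μ = ν := by
  refine Measure.ext_of_charFun (funext fun ξ => ?_)
  rw [charFun_eq_tsum_moments μ hμ, charFun_eq_tsum_moments ν hν]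
  simp only [h]

end MethodOfMoments

/-! ### Powers of the generating series of one displacement -/

/-- The coefficient `(x)_m / m! * E_m(s) Γ(y) / Γ(y + m / 2)` of `zᵐ` in the generating series of
one displacement, for the Dirichlet parameter `x`, `y = d / 2` and `s = ‖ξ‖²`, with `E_m(s)` as in
`evenMoment`. -/
noncomputable def flightCoeff (s x y : ℝ) (m : ℕ) : ℝ :=
  evenMoment s m * (Real.Gamma y / Real.Gamma (y + (m : ℝ) / 2)) *
    (Real.Gamma (x + m) / Real.Gamma x) / m.factorial

theorem flightCoeff_two_mul (s : ℝ) {x y : ℝ} (hx : 0 < x) (hy : 0 < y) (k : ℕ) :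
    flightCoeff s x y (2 * k) = momentCoeff x y k * s ^ k := by
  have h1 := Real.Gamma_pos_of_pos hx
  have h2 := Real.Gamma_pos_of_pos hy
  have h3 : 0 < Real.Gamma (y + k) := Real.Gamma_pos_of_pos (by positivity)
  rw [flightCoeff, momentCoeff, evenMoment_two_mul, ascPochhammer_eval_eq_Gamma hx,
    ascPochhammer_eval_eq_Gamma hy,
    show y + ((2 * k : ℕ) : ℝ) / 2 = y + k by push_cast; ring]
  field_simp

theorem flightCoeff_of_odd {m : ℕ} (hm : ¬ Even m) (s x y : ℝ) : flightCoeff s x y m = 0 := by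
  simp [flightCoeff, evenMoment_of_odd hm]

theorem sum_antidiagonal_flightCoeff {δ : ℝ → ℝ} (hδ : ∀ x, 0 < x → 0 < δ x)
    (hconv : ∀ (n : ℕ) (x y : ℝ), 0 < x → 0 < y →
      ∑ p ∈ antidiagonal n, momentCoeff x (δ x) p.1 * momentCoeff y (δ y) p.2 =
        momentCoeff (x + y) (δ (x + y)) n)
    (s : ℝ) {x y : ℝ} (hx : 0 < x) (hy : 0 < y) (m : ℕ) :
    ∑ p ∈ antidiagonal m, flightCoeff s x (δ x) p.1 * flightCoeff s y (δ y) p.2 =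
      flightCoeff s (x + y) (δ (x + y)) m := by
  rcases Nat.even_or_odd' m with ⟨k, rfl | rfl⟩
  · rw [sum_antidiagonal_two_mul _ _ (fun p _ hp => by simp [flightCoeff_of_odd hp]),
      flightCoeff_two_mul s (add_pos hx hy) (hδ _ (add_pos hx hy)), ← hconv k x y hx hy,
      Finset.sum_mul]
    refine Finset.sum_congr rfl fun p hp => ?_
    rw [flightCoeff_two_mul s hx (hδ _ hx), flightCoeff_two_mul s hy (hδ _ hy),
      ← mem_antidiagonal.1 hp, pow_add]
    ring
  · rw [flightCoeff_of_odd (by simp)]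
    refine sum_antidiagonal_odd _ (by simp) ?_
    rintro p _ (h | h) <;> simp [flightCoeff_of_odd h]

open Finset in
/-- If the coefficients with parameters `x` and `δ x` add up under convolution, the `(n + 1)`-fold
convolution multiplies the parameter `x` by `n + 1`. -/
theorem sum_piAntidiag_prod_flightCoeff {δ : ℝ → ℝ} (hδ : ∀ x, 0 < x → 0 < δ x)
    (hconv : ∀ (n : ℕ) (x y : ℝ), 0 < x → 0 < y →
      ∑ p ∈ HasAntidiagonal.antidiagonal n, momentCoeff x (δ x) p.1 * momentCoeff y (δ y) p.2 =
        momentCoeff (x + y) (δ (x + y)) n)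
    (s : ℝ) {x : ℝ} (hx : 0 < x) (n m : ℕ) :
    ∑ k ∈ piAntidiag (univ : Finset (Fin (n + 1))) m, ∏ j, flightCoeff s x (δ x) (k j) =
      flightCoeff s (((n : ℝ) + 1) * x) (δ (((n : ℝ) + 1) * x)) m := by
  have hpow : ∀ n : ℕ, (PowerSeries.mk (flightCoeff s x (δ x))) ^ (n + 1) =
      PowerSeries.mk (flightCoeff s (((n : ℝ) + 1) * x) (δ (((n : ℝ) + 1) * x))) := by
    intro n
    induction n with
    | zero => simp
    | succ n ih =>
      have hnx : 0 < ((n : ℝ) + 1) * x := by positivity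
      rw [pow_succ, ih]
      ext m
      rw [PowerSeries.coeff_mul]
      simp only [PowerSeries.coeff_mk]
      rw [sum_antidiagonal_flightCoeff hδ hconv s hnx hx,
        show ((n : ℝ) + 1) * x + x = (((n + 1 : ℕ) : ℝ) + 1) * x by push_cast; ring]
  have h := congrArg (PowerSeries.coeff m) (hpow n)
  rw [PowerSeries.coeff_mk] at h
  rw [← h, ← Fin.prod_const, PowerSeries.coeff_prod]
  simp only [PowerSeries.coeff_mk]
  refine (sum_nbij' (fun l : Fin (n + 1) →₀ ℕ => (l : Fin (n + 1) → ℕ))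
    (fun k => Finsupp.equivFunOnFinite.symm k) ?_ ?_ ?_ ?_ ?_).symm
  · intro l hl; simpa using hl
  · intro k hk; simpa using hk
  · intro l _; simp
  · intro k _; simp
  · intro l _; rfl

/-! ### The law of the position -/

theorem measurable_position {d n : ℕ} (hd : 2 ≤ d) (c t : ℝ) :
    Measurable fun q : (Fin (n + 1) → Angles d) × (Fin n → ℝ) => position c t q.1 q.2 := by
  have h := measurable_direction d hd
  unfold position
  fun_prop

theorem inner_position {d n : ℕ} (c t : ℝ) (θ : Fin (n + 1) → Angles d) (τ : Fin n → ℝ)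
    (ξ : EuclideanSpace ℝ (Fin d)) :
    inner ℝ (position c t θ τ) ξ = c * ∑ j, intertimes t τ j * inner ℝ (direction d (θ j)) ξ := by
  simp [position, real_inner_smul_left, sum_inner]

theorem norm_position_le {d n : ℕ} (hd : 2 ≤ d) {c t : ℝ} (hc : 0 < c) (ht : 0 < t)
    (θ : Fin (n + 1) → Angles d) {τ : Fin n → ℝ} (hτ : τ ∈ timeRegion n t) :
    ‖position c t θ τ‖ ≤ c * t := by
  rw [position, norm_smul, Real.norm_of_nonneg hc.le]
  refine mul_le_mul_of_nonneg_left ((norm_sum_le _ _).trans_eq ?_) hc.le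
  nth_rw 2 [← sum_intertimes t τ]
  refine Finset.sum_congr rfl fun j _ => ?_
  rw [norm_smul, norm_direction hd, mul_one, Real.norm_of_nonneg (intertimes_pos ht hτ j).le]

theorem integrable_inner_direction_pow {d : ℕ} (hd : 2 ≤ d) [IsFiniteMeasure (angleLaw d)]
    (ξ : EuclideanSpace ℝ (Fin d)) (k : ℕ) :
    Integrable (fun a => inner ℝ (direction d a) ξ ^ k) (angleLaw d) := by
  have h := measurable_direction d hd
  refine Integrable.of_bound (Measurable.aestronglyMeasurable (by fun_prop)) (‖ξ‖ ^ k)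
    (Filter.Eventually.of_forall fun a => ?_)
  rw [norm_pow]
  gcongr
  refine (norm_inner_le_norm _ _).trans_eq ?_
  rw [norm_direction hd, one_mul]

theorem integrable_prod_intertimes_pow {n : ℕ} {a t : ℝ} (ht : 0 < t)
    [IsFiniteMeasure (dirichletLaw n a t)] (k : Fin (n + 1) → ℕ) :
    Integrable (fun τ => ∏ j, intertimes t τ j ^ k j) (dirichletLaw n a t) := by
  refine Integrable.of_bound (Measurable.aestronglyMeasurable (by fun_prop)) (∏ j, t ^ k j) ?_
  filter_upwards [ae_dirichletLaw_mem n a t] with τ hτ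
  rw [norm_prod]
  refine Finset.prod_le_prod (fun j _ => norm_nonneg _) fun j _ => ?_
  have hpos := intertimes_pos ht hτ
  rw [norm_pow, Real.norm_of_nonneg (hpos j).le]
  refine pow_le_pow_left₀ (hpos j).le ?_ _
  conv_rhs => rw [← sum_intertimes t τ]
  exact Finset.single_le_sum (fun i _ => (hpos i).le) (Finset.mem_univ j)

open Finset in
/-- The moments of the position for independent angles and intertimes. The factor `Γ(A) / Γ(A + m)`,
`A = (n + 1) a`, of the Dirichlet moments cancels against that in `flightCoeff` with parameter
`A`. -/
theorem integral_inner_position_pow {d n : ℕ} (hd : 2 ≤ d) {δ : ℝ → ℝ}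
    (hδ : ∀ x, 0 < x → 0 < δ x)
    (hconv : ∀ (n : ℕ) (x y : ℝ), 0 < x → 0 < y →
      ∑ p ∈ HasAntidiagonal.antidiagonal n, momentCoeff x (δ x) p.1 * momentCoeff y (δ y) p.2 =
        momentCoeff (x + y) (δ (x + y)) n)
    {a t : ℝ} (ha : 0 < a) (ht : 0 < t) (hda : δ a = (d : ℝ) / 2) (c : ℝ)
    [IsProbabilityMeasure (angleLaw d)] [IsProbabilityMeasure (dirichletLaw n a t)]
    (ξ : EuclideanSpace ℝ (Fin d)) (m : ℕ) :
    ∫ q, inner ℝ (position c t q.1 q.2) ξ ^ m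
        ∂(Measure.pi fun _ : Fin (n + 1) => angleLaw d).prod (dirichletLaw n a t) =
      (c * t) ^ m * evenMoment (‖ξ‖ ^ 2) m * (Real.Gamma (δ (((n : ℝ) + 1) * a)) /
        Real.Gamma (δ (((n : ℝ) + 1) * a) + (m : ℝ) / 2)) := by
  have hA : 0 < ((n : ℝ) + 1) * a := by positivity
  have hexp : ∀ q : (Fin (n + 1) → Angles d) × (Fin n → ℝ),
      inner ℝ (position c t q.1 q.2) ξ ^ m =
      ∑ k ∈ piAntidiag (univ : Finset (Fin (n + 1))) m,
        (c ^ m * Nat.multinomial univ k) * ((∏ j, inner ℝ (direction d (q.1 j)) ξ ^ k j) *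
          ∏ j, intertimes t q.2 j ^ k j) := by
    intro q
    rw [inner_position, mul_pow, sum_pow_eq_sum_piAntidiag, mul_sum]
    refine sum_congr rfl fun k _ => ?_
    rw [← prod_mul_distrib, mul_assoc]
    congr 2
    refine prod_congr rfl fun j _ => ?_
    rw [mul_pow, mul_comm]
  simp only [hexp]
  rw [integral_finsetSum]
  swap
  · intro k _
    refine Integrable.const_mul ?_ _
    refine Integrable.mul_prod (f := fun θ : Fin (n + 1) → Angles d =>
      ∏ j, inner ℝ (direction d (θ j)) ξ ^ k j) ?_ (integrable_prod_intertimes_pow ht k)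
    exact Integrable.fintype_prod_dep fun j => integrable_inner_direction_pow hd ξ (k j)
  have : SigmaFinite (Measure.pi fun _ : Fin (n + 1) => angleLaw d) := Measure.pi.sigmaFinite _
  have hterm : ∀ k ∈ piAntidiag (univ : Finset (Fin (n + 1))) m,
      ∫ q, (c ^ m * Nat.multinomial univ k) * ((∏ j, inner ℝ (direction d (q.1 j)) ξ ^ k j) *
          ∏ j, intertimes t q.2 j ^ k j)
        ∂(Measure.pi fun _ : Fin (n + 1) => angleLaw d).prod (dirichletLaw n a t) =
      (c * t) ^ m * m.factorial * (Real.Gamma (((n : ℝ) + 1) * a) /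
        Real.Gamma (((n : ℝ) + 1) * a + m)) *
        ∏ j, flightCoeff (‖ξ‖ ^ 2) a (δ a) (k j) := by
    intro k hk
    have hkm : ∑ j, k j = m := (mem_piAntidiag.1 hk).1
    have hmul : (m.factorial : ℝ) = (∏ j, ((k j).factorial : ℝ)) * Nat.multinomial univ k := by
      rw [← hkm, ← Nat.multinomial_spec]; push_cast; rfl
    rw [integral_const_mul, integral_prod_mul (fun θ : Fin (n + 1) → Angles d =>
      ∏ j, inner ℝ (direction d (θ j)) ξ ^ k j) (fun τ => ∏ j, intertimes t τ j ^ k j),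
      integral_fintype_prod_eq_prod (fun j (θ : Angles d) => inner ℝ (direction d θ) ξ ^ k j),
      integral_dirichletLaw_prod_pow ha ht, hkm, hmul]
    simp only [integral_inner_direction_pow hd, flightCoeff, hda]
    simp only [prod_div_distrib, prod_mul_distrib, mul_pow]
    have hne : ∏ j, ((k j).factorial : ℝ) ≠ 0 :=
      prod_ne_zero_iff.2 fun j _ => by positivity
    field_simp
  rw [sum_congr rfl hterm, ← mul_sum, sum_piAntidiag_prod_flightCoeff hδ hconv _ ha, flightCoeff]
  have h1 := (Real.Gamma_pos_of_pos hA).ne'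
  have h2 : Real.Gamma (((n : ℝ) + 1) * a + m) ≠ 0 :=
    (Real.Gamma_pos_of_pos (by positivity)).ne'
  field_simp

/-- Conditioning on an independent event does not change a law. -/
theorem hasLaw_cond_of_indepFun {Ω β : Type*} [MeasurableSpace Ω] [MeasurableSpace β]
    {P : Measure Ω} [IsProbabilityMeasure P] {X : Ω → β} {N : Ω → ℕ} {μ : Measure β}
    (hX : HasLaw X μ P) (hN : Measurable N) (hXN : IndepFun X N P) {n : ℕ}
    (hn : P (N ⁻¹' {n}) ≠ 0) : HasLaw X μ (cond P (N ⁻¹' {n})) := by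
  have hae : AEMeasurable X (cond P (N ⁻¹' {n})) :=
    hX.aemeasurable.mono_ac cond_absolutelyContinuous
  refine ⟨hae, ?_⟩
  ext B hB
  rw [Measure.map_apply_of_aemeasurable hae hB, cond_apply (hN (measurableSet_singleton n)),
    Set.inter_comm, hXN.measure_inter_preimage_eq_mul _ _ hB (measurableSet_singleton n),
    mul_comm (P (X ⁻¹' B)), ← mul_assoc, ENNReal.inv_mul_cancel hn (measure_ne_top _ _), one_mul,
    ← hX.map_eq, Measure.map_apply_of_aemeasurable hX.aemeasurable hB]

theorem map_position_eq_ballLaw {d n : ℕ} {a c t : ℝ} [IsProbabilityMeasure (angleLaw d)]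
    [IsProbabilityMeasure (dirichletLaw n a t)] (hd : 2 ≤ d) {δ : ℝ → ℝ}
    (hδ : ∀ x, 0 < x → 0 < δ x)
    (hconv : ∀ (n : ℕ) (x y : ℝ), 0 < x → 0 < y →
      ∑ p ∈ antidiagonal n, momentCoeff x (δ x) p.1 * momentCoeff y (δ y) p.2 =
        momentCoeff (x + y) (δ (x + y)) n)
    (ha : 0 < a) (hc : 0 < c) (ht : 0 < t) (hda : δ a = (d : ℝ) / 2)
    {b : ℝ} (hb : 0 < b) (hdA : δ (((n : ℝ) + 1) * a) = b + (d : ℝ) / 2) :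
    ((Measure.pi fun _ : Fin (n + 1) => angleLaw d).prod (dirichletLaw n a t)).map
      (fun q => position c t q.1 q.2) = ballLaw d b (c * t) := by
  have := isProbabilityMeasure_ballLaw d hb (mul_pos hc ht)
  have hmeas := measurable_position (n := n) hd c t
  have : SigmaFinite (Measure.pi fun _ : Fin (n + 1) => angleLaw d) := Measure.pi.sigmaFinite _
  have : IsProbabilityMeasure (Measure.pi fun _ : Fin (n + 1) => angleLaw d) :=
    Measure.pi.instIsProbabilityMeasure _
  have := Measure.isProbabilityMeasure_map (μ := (Measure.pi fun _ : Fin (n + 1) =>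
    angleLaw d).prod (dirichletLaw n a t)) hmeas.aemeasurable
  refine ext_of_moments _ _ (B := c * t) ?_ (ae_ballLaw_norm_le d (mul_pos hc ht)) fun ξ m => ?_
  · rw [ae_map_iff hmeas.aemeasurable (measurableSet_le (by fun_prop) (by fun_prop))]
    have hae := (Measure.quasiMeasurePreserving_snd
      (μ := Measure.pi fun _ : Fin (n + 1) => angleLaw d)).ae (ae_dirichletLaw_mem n a t)
    filter_upwards [hae] with q hq using norm_position_le hd hc ht q.1 hq
  · rw [integral_map hmeas.aemeasurable (Measurable.aestronglyMeasurable (by fun_prop)),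
      integral_inner_position_pow hd hδ hconv ha ht hda, hdA,
      integral_inner_pow_ballLaw ξ m hb (mul_pos hc ht)]

/-- The common form of the two results: `δ x = (x + 1) / 2` and `δ x = x + 1` are the functions
for which the convolution hypothesis holds. -/
theorem IsFlightModel.hasLaw_position {Ω : Type*} [MeasurableSpace Ω] {P : Measure Ω}
    [IsProbabilityMeasure P] {d n : ℕ} {a c t : ℝ} {θ : Fin (n + 1) → Ω → Angles d}
    {τ : Ω → Fin n → ℝ} {N : Ω → ℕ} (h : IsFlightModel P d n a t θ τ N)
    (hn : P (N ⁻¹' {n}) ≠ 0) (hd : 2 ≤ d) {δ : ℝ → ℝ}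
    (hδ : ∀ x, 0 < x → 0 < δ x)
    (hconv : ∀ (n : ℕ) (x y : ℝ), 0 < x → 0 < y →
      ∑ p ∈ antidiagonal n, momentCoeff x (δ x) p.1 * momentCoeff y (δ y) p.2 =
        momentCoeff (x + y) (δ (x + y)) n)
    (ha : 0 < a) (hc : 0 < c) (ht : 0 < t) (hda : δ a = (d : ℝ) / 2)
    {b : ℝ} (hb : 0 < b) (hdA : δ (((n : ℝ) + 1) * a) = b + (d : ℝ) / 2) :
    HasLaw (fun ω => position c t (fun j => θ j ω) (τ ω)) (ballLaw d b (c * t))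
      (cond P (N ⁻¹' {n})) := by
  have : IsProbabilityMeasure (angleLaw d) := (h.angles 0).isProbabilityMeasure_iff.1 ‹_›
  have : IsProbabilityMeasure (dirichletLaw n a t) := h.times.isProbabilityMeasure_iff.1 ‹_›
  have hjoint : HasLaw (fun ω => ((fun j => θ j ω), τ ω))
      ((Measure.pi fun _ : Fin (n + 1) => angleLaw d).prod (dirichletLaw n a t)) P :=
    IndepFun.hasLaw_prod (iIndepFun.hasLaw_pi h.angles h.indep_angles) h.times h.indep_times
  have hcond := hasLaw_cond_of_indepFun hjoint h.measurable_number h.indep_number hn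
  have hpos : HasLaw (fun q : (Fin (n + 1) → Angles d) × (Fin n → ℝ) => position c t q.1 q.2)
      (ballLaw d b (c * t))
      ((Measure.pi fun _ : Fin (n + 1) => angleLaw d).prod (dirichletLaw n a t)) :=
    ⟨(measurable_position hd c t).aemeasurable,
      map_position_eq_ballLaw hd hδ hconv ha hc ht hda hb hdA⟩
  have hcomp := hpos.comp hcond
  exact hcomp

theorem ballDensity_eq_indicator (d : ℕ) {b R : ℝ} (hR : 0 < R) :
    ballDensity d b R = Set.indicator {x | ‖x‖ < R} fun x =>
      Real.Gamma (b + (d : ℝ) / 2) / Real.Gamma b * ((R ^ 2 - ‖x‖ ^ 2) ^ (b - 1) /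
        (Real.pi ^ ((d : ℝ) / 2) * R ^ (2 * (b + (d : ℝ) / 2 - 1)))) := by
  ext x
  have hiff : 0 < R ^ 2 - ‖x‖ ^ 2 ↔ ‖x‖ < R := by
    rw [sub_pos, sq_lt_sq₀ (norm_nonneg x) hR.le]
  simp only [ballDensity, truncPow, hiff, Set.indicator_apply, Set.mem_ofPred_eq,
    pi_rpow_half]
  split_ifs
  · ring
  · simp

theorem densityX_eq_ballDensity (d n : ℕ) {c t : ℝ} (hc : 0 < c) (ht : 0 < t) :
    densityX d n c t = ballDensity d ((n : ℝ) / 2 * ((d : ℝ) - 1)) (c * t) := by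
  rw [ballDensity_eq_indicator d (mul_pos hc ht), densityX,
    show ((n : ℝ) + 1) / 2 * ((d : ℝ) - 1) + 1 / 2 = n / 2 * ((d : ℝ) - 1) + d / 2 by ring,
    show ((n : ℝ) + 1) * ((d : ℝ) - 1) - 1 = 2 * (n / 2 * ((d : ℝ) - 1) + d / 2 - 1) by ring]
  simp only [mul_pow]

theorem densityY_eq_ballDensity (d n : ℕ) {c t : ℝ} (hc : 0 < c) (ht : 0 < t) :
    densityY d n c t = ballDensity d ((n : ℝ) * ((d : ℝ) / 2 - 1)) (c * t) := by
  rw [ballDensity_eq_indicator d (mul_pos hc ht), densityY,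
    show ((n : ℝ) + 1) * ((d : ℝ) / 2 - 1) + 1 = n * ((d : ℝ) / 2 - 1) + d / 2 by ring,
    show 2 * ((n : ℝ) + 1) * ((d : ℝ) / 2 - 1) = 2 * (n * ((d : ℝ) / 2 - 1) + d / 2 - 1) by ring]
  simp only [mul_pow]

end RandomFlight

theorem theorem2 {Ω : Type*} [MeasurableSpace Ω] (P : Measure Ω) [IsProbabilityMeasure P]
    (c t : ℝ) (hc : 0 < c) (ht : 0 < t) (n : ℕ) (hn : 1 ≤ n) :
    (∀ d : ℕ, 2 ≤ d →
      ∀ (θ : Fin (n + 1) → Ω → RandomFlight.Angles d) (τ : Ω → Fin n → ℝ) (N : Ω → ℕ),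
        RandomFlight.IsFlightModel P d n ((d : ℝ) - 1) t θ τ N →
        P (N ⁻¹' {n}) ≠ 0 →
        HasLaw (fun ω => RandomFlight.position c t (fun j => θ j ω) (τ ω))
          (volume.withDensity fun x => ENNReal.ofReal (RandomFlight.densityX d n c t x))
          (ProbabilityTheory.cond P (N ⁻¹' {n}))) ∧
    (∀ d : ℕ, 3 ≤ d →
      ∀ (θ : Fin (n + 1) → Ω → RandomFlight.Angles d) (τ : Ω → Fin n → ℝ) (M : Ω → ℕ),
        RandomFlight.IsFlightModel P d n ((d : ℝ) / 2 - 1) t θ τ M →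
        P (M ⁻¹' {n}) ≠ 0 →
        HasLaw (fun ω => RandomFlight.position c t (fun j => θ j ω) (τ ω))
          (volume.withDensity fun y => ENNReal.ofReal (RandomFlight.densityY d n c t y))
          (ProbabilityTheory.cond P (M ⁻¹' {n}))) := by
  have hn' : (1 : ℝ) ≤ n := by exact_mod_cast hn
  refine ⟨fun d hd θ τ N h hN => ?_, fun d hd θ τ M h hM => ?_⟩
  · have hd' : (2 : ℝ) ≤ d := by exact_mod_cast hd
    rw [RandomFlight.densityX_eq_ballDensity d n hc ht]
    exact h.hasLaw_position hN hd (δ := fun x => (x + 1) / 2) (fun x hx => by positivity)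
      (fun n x y hx hy => RandomFlight.sum_antidiagonal_momentCoeff_half n hx hy)
      (by linarith) hc ht (by ring)
      (mul_pos (by linarith) (by linarith)) (by ring)
  · have hd' : (3 : ℝ) ≤ d := by exact_mod_cast hd
    rw [RandomFlight.densityY_eq_ballDensity d n hc ht]
    exact h.hasLaw_position hM (by omega) (δ := fun x => x + 1) (fun x hx => by positivity)
      (fun n x y hx hy => RandomFlight.sum_antidiagonal_momentCoeff_add_one n hx hy)
      (by linarith) hc ht (by ring)
      (mul_pos (by linarith) (by linarith)) (by ring)
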